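/- Let $N\ge 2$, let $\Omega\subset\mathbb{R}^N$ be bounded and open, and let $1<p\le N$. For $k>0$ let $T_k(s)=s$ if $|s|\le k$ and $T_k(s)=k\,s/|s|$ if $|s|>k$. Let $\varphi_p:\mathbb{R}\to\mathbb{R}$ be the increasing diffeomorphism with $$\varphi_p(0)=0,\qquad \varphi_p'(s)=\frac{1}{\{(1+s^2)[\log(e+s^2)]^4\}^{1/(2p)}}.$$ Let $\Phi^{1,p}_0(\Omega)$ be the set of (classes of a.e. equal) functions $u:\Omega\to\mathbb{R}$ such that $\varphi_p(u)\in W^{1,p}_0(\Omega)$, with the metric $d(u,v)=\|\nabla[\varphi_p(u)]-\nabla[\varphi_p(v)]\|_{L^p(\Omega)}$. For $u\in\Phi^{1,p}_0(\Omega)$, one has $T_k(u)\in W^{1,p}_0(\Omega)$ for every $k>0$, and $\nabla u$ denotes the (a.e. unique) measurable function $\Omega\to\mathbb{R}^N$ such that $\nabla[T_k(u)]=\chi_{\{|u|<k\}}\nabla u$ a.e. in $\Omega$ for every $k>0$. Below, $q$ ranges over all real numbers with $0<q<\frac{N}{N-1}$, and $r$ over all real numbers with $0<r<\frac{N}{N-p}$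 if $p<N$, and with $0<r<\infty$ if $p=N$. Vectors $|\xi|^{p-2}\xi$ and numbers $|s|^{p-2}s$ are understood to be $0$ at $\xi=0$, $s=0$. Then: (a) If $u\in\Phi^{1,p}_0(\Omega)$, then $|\nabla u|^{p-1}\in L^q(\Omega)$ and $|u|^{p-1}\in L^r(\Omega)$ for all such $q$ and $r$. (b) If $(u_n)$ is bounded in $\Phi^{1,p}_0(\Omega)$, then $(|\nabla u_n|^{p-1})$ is bounded in $L^q(\Omega)$ for all such $q$; moreover, there exist $u\in\Phi^{1,p}_0(\Omega)$ and a subsequence $(u_{n_j})$ such that $|u_{n_j}|^{p-2}u_{n_j}\to|u|^{p-2}u$ strongly in $L^r(\Omega)$ for all such $r$. (c) If $u_n,u\in\Phi^{1,p}_0(\Omega)$, $(u_n)$ is bounded in $\Phi^{1,p}_0(\Omega)$ and $\nabla u_n\to\nabla u$ a.e. in $\Omega$, then $|\nabla u_n|^{p-2}\nabla u_n\to|\nabla u|^{p-2}\nabla u$ strongly in $L^q(\Omega;\mathbb{R}^N)$ for all such $q$. (d) If $(u_n)$ converges to $u$ in $\Phi^{1,p}_0(\Omega)$, then $T_k(u_n)\to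 T_k(u)$ strongly in $W^{1,p}_0(\Omega)$ for every $k>0$. -/

import Mathlib

open MeasureTheory Set Filter Topology
open scoped ENNReal NNReal ContDiff

/-- A test function on `Ω`, i.e. an element of `C_c^∞(Ω)`, extended by zero. -/
def IsTest {N : ℕ} (Ω : Set (EuclideanSpace ℝ (Fin N))) (ζ : EuclideanSpace ℝ (Fin N) → ℝ) :
    Prop :=
  ContDiff ℝ ∞ ζ ∧ HasCompactSupport ζ ∧ tsupport ζ ⊆ Ω

/-- `G` is a weak (distributional) gradient of `v` on `Ω`. -/
def HasWeakGrad {N : ℕ} (Ω : Set (EuclideanSpace ℝ (Fin N)))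
    (v : EuclideanSpace ℝ (Fin N) → ℝ)
    (G : EuclideanSpace ℝ (Fin N) → EuclideanSpace ℝ (Fin N)) : Prop :=
  LocallyIntegrableOn v Ω ∧ LocallyIntegrableOn G Ω ∧
    ∀ ζ, IsTest Ω ζ → ∫ x in Ω, v x • gradient ζ x = - ∫ x in Ω, ζ x • G x

/-- A weak gradient is unique up to equality almost everywhere on the open set `Ω`. -/
theorem HasWeakGrad.ae_unique {N : ℕ} {Ω : Set (EuclideanSpace ℝ (Fin N))} (hΩ : IsOpen Ω)
    {v : EuclideanSpace ℝ (Fin N) → ℝ}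
    {G H : EuclideanSpace ℝ (Fin N) → EuclideanSpace ℝ (Fin N)}
    (hG : HasWeakGrad Ω v G) (hH : HasWeakGrad Ω v H) : G =ᵐ[volume.restrict Ω] H := by
  obtain ⟨-, lG, eG⟩ := hG
  obtain ⟨-, lH, eH⟩ := hH
  have key : ∀ᵐ x ∂(volume : Measure (EuclideanSpace ℝ (Fin N))), x ∈ Ω → (G - H) x = 0 := by
    refine hΩ.ae_eq_zero_of_integral_contDiff_smul_eq_zero (lG.sub lH) ?_
    intro g hg hc hs
    have hint : ∀ F : EuclideanSpace ℝ (Fin N) → EuclideanSpace ℝ (Fin N),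
        LocallyIntegrableOn F Ω → Integrable (fun x => g x • F x) := by
      intro F hF
      have h1 : IntegrableOn (fun x => g x • F x) (tsupport g) :=
        (hF.integrableOn_compact_subset hs hc).continuousOn_smul
          hg.continuous.continuousOn hc
      rwa [integrableOn_iff_integrable_of_support_subset] at h1
      exact (Function.support_smul_subset_left g F).trans (subset_tsupport g)
    have hset : ∀ F : EuclideanSpace ℝ (Fin N) → EuclideanSpace ℝ (Fin N),
        ∫ x in Ω, g x • F x = ∫ x, g x • F x := fun F =>
      setIntegral_eq_integral_of_forall_compl_eq_zero fun x hx => by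
        rw [image_eq_zero_of_notMem_tsupport fun h => hx (hs h), zero_smul]
    have h := (eG g ⟨hg, hc, hs⟩).symm.trans (eH g ⟨hg, hc, hs⟩)
    rw [hset, hset, neg_inj] at h
    simp only [Pi.sub_apply, smul_sub]
    rw [integral_sub (hint G lG) (hint H lH), h, sub_self]
  rw [EventuallyEq, ae_restrict_iff' hΩ.measurableSet]
  filter_upwards [key] with x hx hxΩ
  exact sub_eq_zero.mp (hx hxΩ)

open Classical in
/-- The weak gradient of `v` on `Ω` (a representative of it; zero if there is none). -/
noncomputable def weakGrad {N : ℕ} (Ω : Set (EuclideanSpace ℝ (Fin N)))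
    (v : EuclideanSpace ℝ (Fin N) → ℝ) :
    EuclideanSpace ℝ (Fin N) → EuclideanSpace ℝ (Fin N) :=
  if h : ∃ G, HasWeakGrad Ω v G then h.choose else 0

/-- `v ∈ W^{1,p}(Ω)`. -/
def MemW1p {N : ℕ} (p : ℝ) (Ω : Set (EuclideanSpace ℝ (Fin N)))
    (v : EuclideanSpace ℝ (Fin N) → ℝ) : Prop :=
  MemLp v (ENNReal.ofReal p) (volume.restrict Ω) ∧
    ∃ G, HasWeakGrad Ω v G ∧ MemLp G (ENNReal.ofReal p) (volume.restrict Ω)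

/-- `v ∈ W^{1,p}_0(Ω)`, the closure of `C_c^∞(Ω)` in `W^{1,p}(Ω)`. -/
def MemW1p0 {N : ℕ} (p : ℝ) (Ω : Set (EuclideanSpace ℝ (Fin N)))
    (v : EuclideanSpace ℝ (Fin N) → ℝ) : Prop :=
  MemW1p p Ω v ∧ ∀ ε : ℝ≥0∞, 0 < ε → ∃ ζ, IsTest Ω ζ ∧
    eLpNorm (v - ζ) (ENNReal.ofReal p) (volume.restrict Ω) < ε ∧
    eLpNorm (weakGrad Ω v - gradient ζ) (ENNReal.ofReal p) (volume.restrict Ω) < ε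

/-- Strong convergence in `W^{1,p}_0(Ω)`. -/
def TendstoW1p0 {N : ℕ} (p : ℝ) (Ω : Set (EuclideanSpace ℝ (Fin N)))
    (v : ℕ → EuclideanSpace ℝ (Fin N) → ℝ) (w : EuclideanSpace ℝ (Fin N) → ℝ) : Prop :=
  (∀ n, MemW1p0 p Ω (v n)) ∧ MemW1p0 p Ω w ∧
    Tendsto (fun n => eLpNorm (v n - w) (ENNReal.ofReal p) (volume.restrict Ω)) atTop (𝓝 0) ∧
    Tendsto (fun n => eLpNorm (weakGrad Ω (v n) - weakGrad Ω w) (ENNReal.ofReal p)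
      (volume.restrict Ω)) atTop (𝓝 0)

/-- Strong convergence in `L^q(Ω; F)`, `0 < q < ∞`. -/
def TendstoLq {N : ℕ} {F : Type*} [NormedAddCommGroup F] (q : ℝ)
    (Ω : Set (EuclideanSpace ℝ (Fin N)))
    (f : ℕ → EuclideanSpace ℝ (Fin N) → F) (g : EuclideanSpace ℝ (Fin N) → F) : Prop :=
  (∀ n, MemLp (f n) (ENNReal.ofReal q) (volume.restrict Ω)) ∧
    MemLp g (ENNReal.ofReal q) (volume.restrict Ω) ∧
    Tendsto (fun n => eLpNorm (f n - g) (ENNReal.ofReal q) (volume.restrict Ω)) atTop (𝓝 0)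

/-- The truncation `T_k`. -/
noncomputable def trunc (k s : ℝ) : ℝ := if |s| ≤ k then s else k * (s / |s|)

/-- `G` is the gradient of `u` in the sense of truncations: for every `k > 0`, the truncation
`T_k(u)` is in `W^{1,p}_0(Ω)` and its weak gradient is `T_k'(u) G`, i.e. `G` on `{|u| < k}` and
zero elsewhere. Such a `G` is unique almost everywhere on `Ω`. -/
def HasTruncGrad {N : ℕ} (p : ℝ) (Ω : Set (EuclideanSpace ℝ (Fin N)))
    (u : EuclideanSpace ℝ (Fin N) → ℝ)
    (G : EuclideanSpace ℝ (Fin N) → EuclideanSpace ℝ (Fin N)) : Prop :=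
  AEStronglyMeasurable G (volume.restrict Ω) ∧
    ∀ k : ℝ, 0 < k → MemW1p0 p Ω (fun x => trunc k (u x)) ∧
      weakGrad Ω (fun x => trunc k (u x)) =ᵐ[volume.restrict Ω] indicator {x | |u x| < k} G

open Classical in
/-- The gradient `∇u` in the sense of truncations (a representative; zero if there is none). -/
noncomputable def truncGrad {N : ℕ} (p : ℝ) (Ω : Set (EuclideanSpace ℝ (Fin N)))
    (u : EuclideanSpace ℝ (Fin N) → ℝ) :
    EuclideanSpace ℝ (Fin N) → EuclideanSpace ℝ (Fin N) :=
  if h : ∃ G, HasTruncGrad p Ω u G then h.choose else 0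

/-- The diffeomorphism `φ_p` of `ℝ`: `φ_p(0) = 0` and
`φ_p'(s) = {(1 + s²) [log (e + s²)]⁴}^{-1/(2p)}`. -/
noncomputable def phi (p s : ℝ) : ℝ :=
  ∫ t in (0 : ℝ)..s, 1 / ((1 + t ^ 2) * Real.log (Real.exp 1 + t ^ 2) ^ 4) ^ (1 / (2 * p))

/-- `u ∈ Φ^{1,p}_0(Ω)`. -/
def MemPhi {N : ℕ} (p : ℝ) (Ω : Set (EuclideanSpace ℝ (Fin N)))
    (u : EuclideanSpace ℝ (Fin N) → ℝ) : Prop :=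
  MemW1p0 p Ω (fun x => phi p (u x))

/-- The distance `‖∇[φ_p(u)] - ∇[φ_p(v)]‖_p` of `Φ^{1,p}_0(Ω)`. -/
noncomputable def phiDist {N : ℕ} (p : ℝ) (Ω : Set (EuclideanSpace ℝ (Fin N)))
    (u v : EuclideanSpace ℝ (Fin N) → ℝ) : ℝ≥0∞ :=
  eLpNorm (weakGrad Ω (fun x => phi p (u x)) - weakGrad Ω (fun x => phi p (v x)))
    (ENNReal.ofReal p) (volume.restrict Ω)

/-- `(u_n)` is a bounded sequence in the metric space `Φ^{1,p}_0(Ω)`. -/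
def BoundedInPhi {N : ℕ} (p : ℝ) (Ω : Set (EuclideanSpace ℝ (Fin N)))
    (u : ℕ → EuclideanSpace ℝ (Fin N) → ℝ) : Prop :=
  (∀ n, MemPhi p Ω (u n)) ∧ ∃ C : ℝ≥0, ∀ m n, phiDist p Ω (u m) (u n) ≤ C

/-- `(u_n)` converges to `u` in the metric space `Φ^{1,p}_0(Ω)`. -/
def TendstoPhi {N : ℕ} (p : ℝ) (Ω : Set (EuclideanSpace ℝ (Fin N)))
    (u : ℕ → EuclideanSpace ℝ (Fin N) → ℝ) (w : EuclideanSpace ℝ (Fin N) → ℝ) : Prop :=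
  (∀ n, MemPhi p Ω (u n)) ∧ MemPhi p Ω w ∧
    Tendsto (fun n => phiDist p Ω (u n) w) atTop (𝓝 0)

/-! ### Convergence in `L^p` -/

section Lp

variable {α F : Type*} [MeasurableSpace α] {μ : Measure α} [NormedAddCommGroup F]

/-! Everything is read off from v = φ_p(u), which lies in W^{1,p}_0, and from its gradient G. Up to
logarithms φ_p'(s) behaves like |s|^{-1/p} and φ_p(s) like |s|^{1-1/p}. Formally ∇u = G / φ_p'(u),
so that, up to arbitrarily small losses in the exponents, |u|^{p-1} is controlled by (1 + |v|)^p and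
|∇u|^{p-1} by (1 + |v|) |G|^{p-1}. The Sobolev inequality puts v in every L^s below the critical
exponent Np/(N-p) (in every L^s if p = N). Hölder's inequality then gives the stated ranges of r and
q, with bounds that depend only on ‖G‖_p (`exists_eLpNorm_abs_rpow_le`,
`exists_eLpNorm_norm_grad_rpow_le`). Since these ranges are open, the small losses are harmless, and
a bound at a slightly larger exponent together with a.e. convergence gives strong convergence by
Vitali's theorem (`TendstoLq.of_bounded`). This proves (a), (c), and (b) once a subsequence
converges a.e. to an element of the space.

That subsequence comes from compactness in W^{1,p}_0 (`exists_subseq_ae_tendsto_of_bounded`).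
Rellich's theorem in L^1 is obtained by mollification and Arzelà–Ascoli. The limit belongs to
W^{1,p}_0 by a Mazur-type argument: convex combinations of nearly minimal gradient energy have
gradients that converge strongly, by uniform convexity of L^p.

Truncations are handled through the inverse ψ of φ_p: T_k(u) is the integral from 0 to v of χ_{|t| <
φ_p(k)} ψ'(t). The chain rule `HasGradW0.integral_comp` applies to integrands that are everywhere
limits of uniformly bounded smooth functions, hence to this one, and it fixes the value of the
integrand at its jumps. For (d), the jumps at ±φ_p(k) do no harm, because ∇v vanishes a.e. on level
sets of v. Throughout, `HasGradW0` carries an explicit gradient along with the function, so that no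
weak gradient has to be chosen. -/

theorem eLpNorm_ofReal_eq {p : ℝ} (hp : 0 < p) (f : α → F) :
    eLpNorm f (ENNReal.ofReal p) μ = (∫⁻ x, ‖f x‖ₑ ^ p ∂μ) ^ (1 / p) := by
  rw [eLpNorm_eq_lintegral_rpow_enorm_toReal (by simpa using hp) ENNReal.ofReal_ne_top,
    ENNReal.toReal_ofReal hp.le]

theorem lintegral_rpow_enorm_eq {p : ℝ} (hp : 0 < p) (f : α → F) :
    ∫⁻ x, ‖f x‖ₑ ^ p ∂μ = eLpNorm f (ENNReal.ofReal p) μ ^ p := by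
  rw [eLpNorm_ofReal_eq hp, ← ENNReal.rpow_mul, one_div_mul_cancel hp.ne', ENNReal.rpow_one]

/-- Working with ∫ ‖f‖^p avoids the triangle inequality, so the convergence theorems below also
cover exponents less than 1. -/
theorem tendsto_eLpNorm_zero_iff {ι : Type*} {l : Filter ι} {p : ℝ} (hp : 0 < p)
    (f : ι → α → F) :
    Tendsto (fun n => eLpNorm (f n) (ENNReal.ofReal p) μ) l (𝓝 0) ↔
      Tendsto (fun n => ∫⁻ x, ‖f n x‖ₑ ^ p ∂μ) l (𝓝 0) := by
  constructor
  · intro h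
    simp_rw [lintegral_rpow_enorm_eq hp]
    simpa [hp, Function.comp_def] using (ENNReal.continuous_rpow_const (y := p)).tendsto 0 |>.comp h
  · intro h
    simp_rw [eLpNorm_ofReal_eq hp]
    have := ((ENNReal.continuous_rpow_const (y := 1 / p)).tendsto 0).comp h
    simpa [hp, Function.comp_def] using this

/-- Dominated convergence in `L^p`, `0 < p < ∞`. -/
theorem tendsto_eLpNorm_zero_of_dominated {p : ℝ} (hp : 0 < p) {f : ℕ → α → F}
    {b : α → ℝ} (hf : ∀ n, AEStronglyMeasurable (f n) μ)
    (hb : MemLp b (ENNReal.ofReal p) μ) (hfb : ∀ n, ∀ᵐ x ∂μ, ‖f n x‖ ≤ b x)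
    (hlim : ∀ᵐ x ∂μ, Tendsto (fun n => f n x) atTop (𝓝 0)) :
    Tendsto (fun n => eLpNorm (f n) (ENNReal.ofReal p) μ) atTop (𝓝 0) := by
  rw [tendsto_eLpNorm_zero_iff hp]
  have h0 : ∫⁻ _, (0 : ℝ≥0∞) ∂μ = 0 := by simp
  rw [← h0]
  refine tendsto_lintegral_of_dominated_convergence' (fun x => ‖b x‖ₑ ^ p)
    (fun n => (hf n).enorm.pow_const p) (fun n => ?_) ?_ ?_
  · filter_upwards [hfb n] with x hx
    refine ENNReal.rpow_le_rpow ?_ hp.le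
    exact enorm_le_iff_norm_le.2 (hx.trans (le_abs_self _))
  · rw [lintegral_rpow_enorm_eq hp]
    exact ENNReal.rpow_ne_top_of_nonneg hp.le hb.2.ne
  · filter_upwards [hlim] with x hx
    have h1 : Tendsto (fun n => ‖f n x‖ₑ) atTop (𝓝 0) := by
      simpa [Function.comp_def] using (continuous_enorm.tendsto (0 : F)).comp hx
    simpa [hp, Function.comp_def] using ((ENNReal.continuous_rpow_const (y := p)).tendsto 0).comp h1

/-- Vitali's theorem on a finite measure space, for sequences bounded in a higher `L^s`. -/
theorem tendsto_eLpNorm_zero_of_bounded [IsFiniteMeasure μ] {q s : ℝ} (hq : 0 < q) (hqs : q < s)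
    {f : ℕ → α → F} (hf : ∀ n, AEStronglyMeasurable (f n) μ) {C : ℝ≥0}
    (hC : ∀ n, eLpNorm (f n) (ENNReal.ofReal s) μ ≤ C)
    (hlim : ∀ᵐ x ∂μ, Tendsto (fun n => f n x) atTop (𝓝 0)) :
    Tendsto (fun n => eLpNorm (f n) (ENNReal.ofReal q) μ) atTop (𝓝 0) := by
  rw [tendsto_eLpNorm_zero_iff hq]
  have hs : 0 < s := hq.trans hqs
  -- Cutting at height M: where ‖f‖ ≥ M one has ‖f‖^q ≤ M^{q-s} ‖f‖^s, because q - s < 0. The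
  -- truncated part tends to 0 by dominated convergence, and the tail is small uniformly in n for
  -- large M.
  have split : ∀ (M : ℝ) (_ : 0 < M) (n : ℕ), ∫⁻ x, ‖f n x‖ₑ ^ q ∂μ ≤
      ∫⁻ x, min ‖f n x‖ₑ (ENNReal.ofReal M) ^ q ∂μ +
        ENNReal.ofReal (M ^ (q - s)) * (C : ℝ≥0∞) ^ s := by
    intro M hM n
    calc ∫⁻ x, ‖f n x‖ₑ ^ q ∂μ ≤ ∫⁻ x, (min ‖f n x‖ₑ (ENNReal.ofReal M) ^ q +
          ENNReal.ofReal (M ^ (q - s)) * ‖f n x‖ₑ ^ s) ∂μ := by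
          refine lintegral_mono fun x => ?_
          rcases le_total ‖f n x‖ₑ (ENNReal.ofReal M) with h | h
          · simp [min_eq_left h]
          · refine le_add_left ?_
            have h0 : ‖f n x‖ₑ ≠ 0 := fun h' => by
              rw [h'] at h; simp at h; linarith
            have : ‖f n x‖ₑ ^ q = ‖f n x‖ₑ ^ (q - s) * ‖f n x‖ₑ ^ s := by
              rw [← ENNReal.rpow_add _ _ h0 enorm_ne_top]; simp
            rw [this]
            gcongr
            rw [← ENNReal.ofReal_rpow_of_pos hM, ← neg_sub s q, ENNReal.rpow_neg,
              ENNReal.rpow_neg]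
            gcongr
      _ = ∫⁻ x, min ‖f n x‖ₑ (ENNReal.ofReal M) ^ q ∂μ +
          ENNReal.ofReal (M ^ (q - s)) * ∫⁻ x, ‖f n x‖ₑ ^ s ∂μ := by
          rw [lintegral_add_right', lintegral_const_mul'']
          · exact (hf n).enorm.pow_const s
          · exact ((hf n).enorm.pow_const s).const_mul _
      _ ≤ _ := by
          gcongr
          rw [lintegral_rpow_enorm_eq hs]
          gcongr
          exact hC n
  have hmin : ∀ M : ℝ, 0 < M →
      Tendsto (fun n => ∫⁻ x, min ‖f n x‖ₑ (ENNReal.ofReal M) ^ q ∂μ) atTop (𝓝 0) := by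
    intro M hM
    have h0 : ∫⁻ _, (0 : ℝ≥0∞) ∂μ = 0 := by simp
    rw [← h0]
    refine tendsto_lintegral_of_dominated_convergence' (fun x => ENNReal.ofReal M ^ q)
      (fun n => ((hf n).enorm.min aemeasurable_const).pow_const q) (fun n => ?_) ?_ ?_
    · filter_upwards with x
      gcongr
      exact min_le_right _ _
    · rw [lintegral_const]
      exact ENNReal.mul_ne_top (ENNReal.rpow_ne_top_of_nonneg hq.le ENNReal.ofReal_ne_top)
        (measure_ne_top _ _)
    · filter_upwards [hlim] with x hx
      have h1 : Tendsto (fun n => ‖f n x‖ₑ) atTop (𝓝 0) := by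
        simpa [Function.comp_def] using (continuous_enorm.tendsto (0 : F)).comp hx
      have h2 : Tendsto (fun n => min ‖f n x‖ₑ (ENNReal.ofReal M)) atTop (𝓝 0) := by
        simpa using h1.min (tendsto_const_nhds (x := ENNReal.ofReal M))
      simpa [hq, Function.comp_def] using
        ((ENNReal.continuous_rpow_const (y := q)).tendsto 0).comp h2
  have htail : Tendsto (fun M : ℝ => ENNReal.ofReal (M ^ (q - s)) * (C : ℝ≥0∞) ^ s)
      atTop (𝓝 0) := by
    have h1 : Tendsto (fun M : ℝ => M ^ (q - s)) atTop (𝓝 0) := by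
      simpa using tendsto_rpow_neg_atTop (sub_pos.2 hqs)
    have h2 := ENNReal.tendsto_ofReal h1
    rw [ENNReal.ofReal_zero] at h2
    simpa using ENNReal.Tendsto.mul_const h2
      (Or.inr (ENNReal.rpow_ne_top_of_nonneg hs.le ENNReal.coe_ne_top))
  rw [ENNReal.tendsto_nhds_zero]
  intro ε hε
  have hε2 : 0 < ε / 2 := ENNReal.half_pos hε.ne'
  obtain ⟨M, hM1, hM2⟩ := ((ENNReal.tendsto_nhds_zero.1 htail _ hε2).and
    (eventually_gt_atTop 0)).exists
  filter_upwards [ENNReal.tendsto_nhds_zero.1 (hmin M hM2) _ hε2] with n hn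
  exact (split M hM2 n).trans ((add_le_add hn hM1).trans_eq (ENNReal.add_halves ε))

/-- A sequence converging in `L^p` has an almost everywhere convergent subsequence. -/
theorem exists_subseq_ae_tendsto {p : ℝ} (hp : 0 < p) {f : ℕ → α → F} {g : α → F}
    (hf : ∀ n, AEStronglyMeasurable (f n) μ) (hg : AEStronglyMeasurable g μ)
    (h : Tendsto (fun n => eLpNorm (f n - g) (ENNReal.ofReal p) μ) atTop (𝓝 0)) :
    ∃ σ : ℕ → ℕ, StrictMono σ ∧
      ∀ᵐ x ∂μ, Tendsto (fun n => f (σ n) x) atTop (𝓝 (g x)) :=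
  (tendstoInMeasure_of_tendsto_eLpNorm (by simpa using hp) hf hg h).exists_seq_tendsto_ae

theorem eLpNorm_le_mul_of_norm_le {G : Type*} [NormedAddCommGroup G] {f : α → F} {g : α → G}
    {c : ℝ} {p : ℝ≥0∞} (h : ∀ᵐ x ∂μ, ‖f x‖ ≤ c * ‖g x‖) :
    eLpNorm f p μ ≤ ENNReal.ofReal c * eLpNorm g p μ :=
  eLpNorm_le_mul_eLpNorm_of_ae_le_mul h p

end Lp

/-! ### Test functions -/

section W0

variable {N : ℕ} {Ω : Set (EuclideanSpace ℝ (Fin N))}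

theorem hasGradientAt_of_hasFDerivAt_eq {f : EuclideanSpace ℝ (Fin N) → ℝ}
    {x : EuclideanSpace ℝ (Fin N)} {L : EuclideanSpace ℝ (Fin N) →L[ℝ] ℝ}
    {v : EuclideanSpace ℝ (Fin N)} (h : HasFDerivAt f L x)
    (hL : L = InnerProductSpace.toDual ℝ _ v) : HasGradientAt f v x := by
  rw [hasGradientAt_iff_hasFDerivAt, ← hL]; exact h

theorem gradient_eq_comp (f : EuclideanSpace ℝ (Fin N) → ℝ) :
    gradient f = fun x => (InnerProductSpace.toDual ℝ _).symm (fderiv ℝ f x) := rfl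

theorem norm_gradient (f : EuclideanSpace ℝ (Fin N) → ℝ) (x : EuclideanSpace ℝ (Fin N)) :
    ‖gradient f x‖ = ‖fderiv ℝ f x‖ := by
  rw [gradient_eq_comp]; simp

namespace IsTest

variable {ζ η : EuclideanSpace ℝ (Fin N) → ℝ}

theorem differentiable (h : IsTest Ω ζ) : Differentiable ℝ ζ := h.1.differentiable (by simp)

theorem continuous (h : IsTest Ω ζ) : Continuous ζ := h.1.continuous

theorem continuous_fderiv (h : IsTest Ω ζ) : Continuous (fderiv ℝ ζ) :=
  h.1.continuous_fderiv (by simp)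

theorem hasGradientAt (h : IsTest Ω ζ) (x : EuclideanSpace ℝ (Fin N)) :
    HasGradientAt ζ (gradient ζ x) x := (h.differentiable x).hasGradientAt

theorem continuous_gradient (h : IsTest Ω ζ) : Continuous (gradient ζ) := by
  rw [gradient_eq_comp]
  exact (InnerProductSpace.toDual ℝ _).symm.continuous.comp h.continuous_fderiv

theorem hasCompactSupport_gradient (h : IsTest Ω ζ) : HasCompactSupport (gradient ζ) := by
  rw [gradient_eq_comp]
  exact (h.2.1.fderiv ℝ).comp_left (g := (InnerProductSpace.toDual ℝ _).symm) (by simp)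

theorem support_subset (h : IsTest Ω ζ) : Function.support ζ ⊆ Ω :=
  (subset_tsupport ζ).trans h.2.2

theorem support_gradient_subset (h : IsTest Ω ζ) : Function.support (gradient ζ) ⊆ Ω := by
  intro x hx
  refine h.2.2 (tsupport_fderiv_subset ℝ (subset_tsupport _ ?_))
  intro h0
  apply hx
  rw [gradient_eq_comp]; simp [h0]

theorem zero : IsTest Ω (0 : EuclideanSpace ℝ (Fin N) → ℝ) :=
  ⟨contDiff_const, HasCompactSupport.zero, by simp⟩

theorem add (h : IsTest Ω ζ) (h' : IsTest Ω η) : IsTest Ω (ζ + η) :=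
  ⟨h.1.add h'.1, h.2.1.add h'.2.1, (tsupport_add _ _).trans (union_subset h.2.2 h'.2.2)⟩

theorem smul (c : ℝ) (h : IsTest Ω ζ) : IsTest Ω (c • ζ) :=
  ⟨h.1.const_smul c, h.2.1.smul_left (f := fun _ => c),
    (tsupport_smul_subset_right (fun _ => c) ζ).trans h.2.2⟩

theorem gradient_add (h : IsTest Ω ζ) (h' : IsTest Ω η) :
    gradient (ζ + η) = gradient ζ + gradient η := by
  ext1 x
  rw [gradient_eq_comp]
  simp [fderiv_add (h.differentiable x) (h'.differentiable x), gradient]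

theorem gradient_smul (c : ℝ) (h : IsTest Ω ζ) : gradient (c • ζ) = c • gradient ζ := by
  ext1 x
  rw [gradient_eq_comp]
  simp [fderiv_const_smul (h.differentiable x), gradient]

/-- Composition with a smooth function vanishing at `0`. -/
theorem comp (h : IsTest Ω ζ) {f : ℝ → ℝ} (hf : ContDiff ℝ ∞ f) (h0 : f 0 = 0) :
    IsTest Ω (f ∘ ζ) :=
  ⟨hf.comp h.1, h.2.1.comp_left h0,
    (tsupport_comp_subset (g := f) h0 ζ).trans h.2.2⟩

theorem gradient_comp (h : IsTest Ω ζ) {f f' : ℝ → ℝ} (hf : ∀ s, HasDerivAt f (f' s) s)  :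
    gradient (f ∘ ζ) = fun x => f' (ζ x) • gradient ζ x := by
  ext1 x
  refine HasGradientAt.gradient (hasGradientAt_of_hasFDerivAt_eq
    ((hf (ζ x)).comp_hasFDerivAt x (h.hasGradientAt x).hasFDerivAt) ?_)
  simp

theorem memLp (h : IsTest Ω ζ) (p : ℝ≥0∞) : MemLp ζ p (volume.restrict Ω) :=
  (h.continuous.memLp_of_hasCompactSupport h.2.1).restrict _

theorem memLp_gradient (h : IsTest Ω ζ) (p : ℝ≥0∞) :
    MemLp (gradient ζ) p (volume.restrict Ω) :=
  (h.continuous_gradient.memLp_of_hasCompactSupport h.hasCompactSupport_gradient).restrict _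

theorem eLpNorm_restrict (h : IsTest Ω ζ) (p : ℝ≥0∞) :
    eLpNorm ζ p (volume.restrict Ω) = eLpNorm ζ p volume :=
  eLpNorm_restrict_eq_of_support_subset h.support_subset

theorem eLpNorm_gradient_restrict (h : IsTest Ω ζ) (p : ℝ≥0∞) :
    eLpNorm (gradient ζ) p (volume.restrict Ω) = eLpNorm (gradient ζ) p volume :=
  eLpNorm_restrict_eq_of_support_subset h.support_gradient_subset

theorem exists_bound (h : IsTest Ω ζ) : ∃ M, 0 ≤ M ∧ ∀ x, ‖ζ x‖ ≤ M ∧ ‖gradient ζ x‖ ≤ M := by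
  obtain ⟨A, hA⟩ := h.2.1.exists_bound_of_continuous h.continuous
  obtain ⟨B, hB⟩ := h.hasCompactSupport_gradient.exists_bound_of_continuous h.continuous_gradient
  exact ⟨max A B, (norm_nonneg _).trans ((hA 0).trans (le_max_left _ _)),
    fun x => ⟨(hA x).trans (le_max_left _ _), (hB x).trans (le_max_right _ _)⟩⟩

/-- Integration by parts for test functions. -/
theorem integral_smul_gradient (h : IsTest Ω ζ) (h' : IsTest Ω η) :
    ∫ x in Ω, ζ x • gradient η x = - ∫ x in Ω, η x • gradient ζ x := by
  have hs : ∀ {ζ η : EuclideanSpace ℝ (Fin N) → ℝ}, IsTest Ω ζ →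
      ∫ x in Ω, ζ x • gradient η x = ∫ x, ζ x • gradient η x := fun h =>
    setIntegral_eq_integral_of_forall_compl_eq_zero fun x hx => by
      rw [Function.notMem_support.1 fun h' => hx (h.support_subset h'), zero_smul]
  have hi : ∀ {ζ η : EuclideanSpace ℝ (Fin N) → ℝ}, IsTest Ω ζ → IsTest Ω η →
      Integrable (fun x => ζ x • gradient η x) := fun h h' =>
    (h.continuous.smul h'.continuous_gradient).integrable_of_hasCompactSupport
      h.2.1.smul_right
  rw [hs h, hs h', eq_neg_iff_add_eq_zero, ← integral_add (hi h h') (hi h' h)]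
  refine ext_inner_right ℝ fun w => ?_
  have hI : Integrable (fun x => ζ x • gradient η x + η x • gradient ζ x) :=
    (hi h h').add (hi h' h)
  rw [inner_zero_left, real_inner_comm, ← integral_inner hI]
  have e : ∀ x, inner ℝ w (ζ x • gradient η x + η x • gradient ζ x) =
      ζ x * fderiv ℝ η x w + fderiv ℝ ζ x w * η x := fun x => by
    rw [inner_add_right, inner_smul_right, inner_smul_right, inner_gradient_right,
      inner_gradient_right]
    simp [mul_comm]
  simp_rw [e]
  have i1 : Integrable (fun x => ζ x * fderiv ℝ η x w) :=
    (h.continuous.mul (h'.continuous_fderiv.clm_apply continuous_const)).integrable_of_hasCompactSupport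
      h.2.1.mul_right
  have i2 : Integrable (fun x => fderiv ℝ ζ x w * η x) :=
    ((h.continuous_fderiv.clm_apply continuous_const).mul h'.continuous).integrable_of_hasCompactSupport
      h'.2.1.mul_left
  have i3 : Integrable (fun x => ζ x * η x) :=
    (h.continuous.mul h'.continuous).integrable_of_hasCompactSupport h'.2.1.mul_left
  rw [integral_add i1 i2, integral_mul_fderiv_eq_neg_fderiv_mul_of_integrable i2 i1 i3
    (fun x _ => h.differentiable x) (fun x _ => h'.differentiable x)]
  simp

end IsTest

/-! ### Functions in `W^{1,p}_0` together with their gradient -/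

theorem isFiniteMeasure_restrict_of_isBounded (hΩb : Bornology.IsBounded Ω) :
    IsFiniteMeasure (volume.restrict Ω) :=
  ⟨by rw [Measure.restrict_apply_univ]; exact hΩb.measure_lt_top⟩

theorem tendsto_eLpNorm_one_of_tendsto {α F : Type*} [MeasurableSpace α] {μ : Measure α}
    [IsFiniteMeasure μ] [NormedAddCommGroup F] {p : ℝ} (hp : 1 ≤ p) {f : ℕ → α → F}
    (hf : ∀ n, AEStronglyMeasurable (f n) μ)
    (h : Tendsto (fun n => eLpNorm (f n) (ENNReal.ofReal p) μ) atTop (𝓝 0)) :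
    Tendsto (fun n => eLpNorm (f n) 1 μ) atTop (𝓝 0) := by
  have hP : 1 ≤ ENNReal.ofReal p := by simpa using ENNReal.ofReal_le_ofReal hp
  have hle := fun n => eLpNorm_le_eLpNorm_mul_rpow_measure_univ hP (hf n)
  refine tendsto_of_tendsto_of_tendsto_of_le_of_le tendsto_const_nhds ?_ (fun _ => zero_le) hle
  have hc : μ univ ^ (1 / (1 : ℝ≥0∞).toReal - 1 / (ENNReal.ofReal p).toReal) ≠ ⊤ := by
    refine ENNReal.rpow_ne_top_of_nonneg ?_ (measure_ne_top _ _)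
    rw [ENNReal.toReal_ofReal (by linarith)]
    have : 1 / p ≤ 1 := (div_le_one (by linarith)).2 hp
    simpa using this
  simpa using ENNReal.Tendsto.mul_const h (Or.inr hc)

theorem weakGrad_ae_eq (hΩ : IsOpen Ω) {v : EuclideanSpace ℝ (Fin N) → ℝ}
    {G : EuclideanSpace ℝ (Fin N) → EuclideanSpace ℝ (Fin N)} (h : HasWeakGrad Ω v G) :
    weakGrad Ω v =ᵐ[volume.restrict Ω] G := by
  have hex : ∃ G, HasWeakGrad Ω v G := ⟨G, h⟩
  rw [weakGrad, dif_pos hex]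
  exact hex.choose_spec.ae_unique hΩ h

/-- `v` is in `W^{1,p}_0(Ω)` with gradient `G`. -/
def HasGradW0 (p : ℝ) (Ω : Set (EuclideanSpace ℝ (Fin N)))
    (v : EuclideanSpace ℝ (Fin N) → ℝ)
    (G : EuclideanSpace ℝ (Fin N) → EuclideanSpace ℝ (Fin N)) : Prop :=
  MemLp v (ENNReal.ofReal p) (volume.restrict Ω) ∧
    MemLp G (ENNReal.ofReal p) (volume.restrict Ω) ∧
    ∀ ε : ℝ≥0∞, 0 < ε → ∃ ζ, IsTest Ω ζ ∧
      eLpNorm (v - ζ) (ENNReal.ofReal p) (volume.restrict Ω) < ε ∧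
      eLpNorm (G - gradient ζ) (ENNReal.ofReal p) (volume.restrict Ω) < ε

theorem IsTest.hasGradW0 {ζ : EuclideanSpace ℝ (Fin N) → ℝ} (h : IsTest Ω ζ) (p : ℝ) :
    HasGradW0 p Ω ζ (gradient ζ) :=
  ⟨h.memLp _, h.memLp_gradient _, fun ε hε => ⟨ζ, h, by simpa using hε, by simpa using hε⟩⟩

namespace HasGradW0

variable {p : ℝ} {v v' : EuclideanSpace ℝ (Fin N) → ℝ}
  {G G' : EuclideanSpace ℝ (Fin N) → EuclideanSpace ℝ (Fin N)}

theorem exists_seq (h : HasGradW0 p Ω v G) : ∃ ζ : ℕ → EuclideanSpace ℝ (Fin N) → ℝ,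
    (∀ n, IsTest Ω (ζ n)) ∧
    Tendsto (fun n => eLpNorm (ζ n - v) (ENNReal.ofReal p) (volume.restrict Ω)) atTop (𝓝 0) ∧
    Tendsto (fun n => eLpNorm (gradient (ζ n) - G) (ENNReal.ofReal p) (volume.restrict Ω))
      atTop (𝓝 0) := by
  have hpos : ∀ n : ℕ, (0 : ℝ≥0∞) < (n : ℝ≥0∞)⁻¹ := fun n => by simp
  choose ζ h1 h2 h3 using fun n : ℕ => h.2.2 _ (hpos n)
  refine ⟨ζ, h1, ?_, ?_⟩
  · refine tendsto_of_tendsto_of_tendsto_of_le_of_le tendsto_const_nhds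
      ENNReal.tendsto_inv_nat_nhds_zero (fun _ => zero_le) fun n => ?_
    rw [eLpNorm_sub_comm]; exact (h2 n).le
  · refine tendsto_of_tendsto_of_tendsto_of_le_of_le tendsto_const_nhds
      ENNReal.tendsto_inv_nat_nhds_zero (fun _ => zero_le) fun n => ?_
    rw [eLpNorm_sub_comm]; exact (h3 n).le

/-- `W^{1,p}_0(Ω)` is closed. -/
theorem of_tendsto (hp : 1 ≤ p) {w : ℕ → EuclideanSpace ℝ (Fin N) → ℝ}
    {H : ℕ → EuclideanSpace ℝ (Fin N) → EuclideanSpace ℝ (Fin N)}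
    (hw : ∀ n, HasGradW0 p Ω (w n) (H n))
    (hv : MemLp v (ENNReal.ofReal p) (volume.restrict Ω))
    (hG : MemLp G (ENNReal.ofReal p) (volume.restrict Ω))
    (hwv : Tendsto (fun n => eLpNorm (w n - v) (ENNReal.ofReal p) (volume.restrict Ω))
      atTop (𝓝 0))
    (hHG : Tendsto (fun n => eLpNorm (H n - G) (ENNReal.ofReal p) (volume.restrict Ω))
      atTop (𝓝 0)) : HasGradW0 p Ω v G := by
  have hP : 1 ≤ ENNReal.ofReal p := by simpa using ENNReal.ofReal_le_ofReal hp
  refine ⟨hv, hG, fun ε hε => ?_⟩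
  have hε2 : 0 < ε / 2 := ENNReal.half_pos hε.ne'
  obtain ⟨n, h1, h2⟩ := ((hwv.eventually (gt_mem_nhds hε2)).and
    (hHG.eventually (gt_mem_nhds hε2))).exists
  obtain ⟨ζ, hζ, h3, h4⟩ := (hw n).2.2 _ hε2
  refine ⟨ζ, hζ, ?_, ?_⟩
  · have e : v - ζ = (v - w n) + (w n - ζ) := by abel
    rw [e, ← ENNReal.add_halves ε]
    rw [eLpNorm_sub_comm] at h1
    exact (eLpNorm_add_le (hv.1.sub (hw n).1.1) ((hw n).1.1.sub (hζ.memLp 1).1) hP).trans_lt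
      (ENNReal.add_lt_add h1 h3)
  · have e : G - gradient ζ = (G - H n) + (H n - gradient ζ) := by abel
    rw [e, ← ENNReal.add_halves ε]
    rw [eLpNorm_sub_comm] at h2
    exact (eLpNorm_add_le (hG.1.sub (hw n).2.1.1)
      ((hw n).2.1.1.sub (hζ.memLp_gradient 1).1) hP).trans_lt (ENNReal.add_lt_add h2 h4)

/-- Integration by parts holds for the approximating test functions. Both sides pass to the limit
because convergence in L^p implies convergence in L^1 on a finite measure space, and η and ∇η are
bounded. -/
theorem hasWeakGrad [IsFiniteMeasure (volume.restrict Ω)] (hp : 1 ≤ p)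
    (h : HasGradW0 p Ω v G) : HasWeakGrad Ω v G := by
  have hP : 1 ≤ ENNReal.ofReal p := by simpa using ENNReal.ofReal_le_ofReal hp
  have iv : Integrable v (volume.restrict Ω) := h.1.integrable hP
  have iG : Integrable G (volume.restrict Ω) := h.2.1.integrable hP
  refine ⟨IntegrableOn.locallyIntegrableOn iv, IntegrableOn.locallyIntegrableOn iG,
    fun η hη => ?_⟩
  obtain ⟨ζ, hζ, h1, h2⟩ := h.exists_seq
  obtain ⟨M, hM0, hM⟩ := hη.exists_bound
  have key : ∀ {f : ℕ → ℝ≥0∞} {g : ℕ → ℝ≥0∞}, Tendsto f atTop (𝓝 0) →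
      (∀ n, g n ≤ ENNReal.ofReal M * f n) → Tendsto g atTop (𝓝 0) := fun hf hg =>
    tendsto_of_tendsto_of_tendsto_of_le_of_le tendsto_const_nhds
      (by simpa using ENNReal.Tendsto.const_mul hf (Or.inr ENNReal.ofReal_ne_top))
      (fun _ => zero_le) hg
  have t1 : Tendsto (fun n => ∫ x in Ω, ζ n x • gradient η x) atTop
      (𝓝 (∫ x in Ω, v x • gradient η x)) := by
    refine tendsto_integral_of_L1' _
      (iv.smul_bdd M hη.continuous_gradient.aestronglyMeasurable
        (ae_of_all _ fun x => (hM x).2)).1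
      (Eventually.of_forall fun n => (((hζ n).memLp 1).integrable le_rfl).smul_bdd M
        hη.continuous_gradient.aestronglyMeasurable (ae_of_all _ fun x => (hM x).2)) ?_
    refine key (tendsto_eLpNorm_one_of_tendsto hp
      (fun n => ((hζ n).memLp 1).1.sub h.1.1) h1) fun n => ?_
    refine eLpNorm_le_mul_of_norm_le (ae_of_all _ fun x => ?_)
    change ‖ζ n x • gradient η x - v x • gradient η x‖ ≤ M * ‖ζ n x - v x‖
    rw [← sub_smul, norm_smul, mul_comm]
    gcongr
    exact (hM x).2
  have t2 : Tendsto (fun n => ∫ x in Ω, η x • gradient (ζ n) x) atTop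
      (𝓝 (∫ x in Ω, η x • G x)) := by
    refine tendsto_integral_of_L1' _
      (iG.bdd_smul M hη.continuous.aestronglyMeasurable (ae_of_all _ fun x => (hM x).1)).1
      (Eventually.of_forall fun n => (((hζ n).memLp_gradient 1).integrable le_rfl).bdd_smul M
        hη.continuous.aestronglyMeasurable (ae_of_all _ fun x => (hM x).1)) ?_
    refine key (tendsto_eLpNorm_one_of_tendsto hp
      (fun n => ((hζ n).memLp_gradient 1).1.sub h.2.1.1) h2) fun n => ?_
    refine eLpNorm_le_mul_of_norm_le (ae_of_all _ fun x => ?_)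
    change ‖η x • gradient (ζ n) x - η x • G x‖ ≤ M * ‖gradient (ζ n) x - G x‖
    rw [← smul_sub, norm_smul]
    gcongr
    exact (hM x).1
  refine tendsto_nhds_unique t1 ?_
  simpa only [(hζ _).integral_smul_gradient hη] using t2.neg

theorem weakGrad_ae_eq [IsFiniteMeasure (volume.restrict Ω)] (hΩ : IsOpen Ω) (hp : 1 ≤ p)
    (h : HasGradW0 p Ω v G) : weakGrad Ω v =ᵐ[volume.restrict Ω] G :=
  _root_.weakGrad_ae_eq hΩ (h.hasWeakGrad hp)

theorem ae_unique [IsFiniteMeasure (volume.restrict Ω)] (hΩ : IsOpen Ω) (hp : 1 ≤ p)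
    (h : HasGradW0 p Ω v G) (h' : HasGradW0 p Ω v G') : G =ᵐ[volume.restrict Ω] G' :=
  (h.hasWeakGrad hp).ae_unique hΩ (h'.hasWeakGrad hp)

theorem memW1p0 [IsFiniteMeasure (volume.restrict Ω)] (hΩ : IsOpen Ω) (hp : 1 ≤ p)
    (h : HasGradW0 p Ω v G) : MemW1p0 p Ω v := by
  refine ⟨⟨h.1, G, h.hasWeakGrad hp, h.2.1⟩, fun ε hε => ?_⟩
  obtain ⟨ζ, hζ, h1, h2⟩ := h.2.2 ε hε
  exact ⟨ζ, hζ, h1,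
    by rwa [eLpNorm_congr_ae ((h.weakGrad_ae_eq hΩ hp).sub (EventuallyEq.refl _ _))]⟩

end HasGradW0

/-- Together with `HasGradW0.memW1p0`, this allows passing freely between the two descriptions of
W^{1,p}_0. -/
theorem MemW1p0.hasGradW0 (hΩ : IsOpen Ω) {p : ℝ} {v : EuclideanSpace ℝ (Fin N) → ℝ}
    (h : MemW1p0 p Ω v) : HasGradW0 p Ω v (weakGrad Ω v) := by
  obtain ⟨⟨hv, G, hG, hGp⟩, hζ⟩ := h
  exact ⟨hv, hGp.ae_eq (weakGrad_ae_eq hΩ hG).symm, hζ⟩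

theorem TendstoW1p0.of_hasGradW0 [IsFiniteMeasure (volume.restrict Ω)] (hΩ : IsOpen Ω) {p : ℝ}
    (hp : 1 ≤ p) {v : ℕ → EuclideanSpace ℝ (Fin N) → ℝ} {w : EuclideanSpace ℝ (Fin N) → ℝ}
    {G : ℕ → EuclideanSpace ℝ (Fin N) → EuclideanSpace ℝ (Fin N)}
    {H : EuclideanSpace ℝ (Fin N) → EuclideanSpace ℝ (Fin N)}
    (hv : ∀ n, HasGradW0 p Ω (v n) (G n)) (hw : HasGradW0 p Ω w H)
    (h1 : Tendsto (fun n => eLpNorm (v n - w) (ENNReal.ofReal p) (volume.restrict Ω))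
      atTop (𝓝 0))
    (h2 : Tendsto (fun n => eLpNorm (G n - H) (ENNReal.ofReal p) (volume.restrict Ω))
      atTop (𝓝 0)) : TendstoW1p0 p Ω v w := by
  refine ⟨fun n => (hv n).memW1p0 hΩ hp, hw.memW1p0 hΩ hp, h1, ?_⟩
  have e : ∀ n, eLpNorm (weakGrad Ω (v n) - weakGrad Ω w) (ENNReal.ofReal p)
      (volume.restrict Ω) = eLpNorm (G n - H) (ENNReal.ofReal p) (volume.restrict Ω) := fun n =>
    eLpNorm_congr_ae (((hv n).weakGrad_ae_eq hΩ hp).sub (hw.weakGrad_ae_eq hΩ hp))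
  simpa only [e] using h2

/-! ### The chain rule in `W^{1,p}_0` -/

theorem integral_zero_to_hasDerivAt {g : ℝ → ℝ} (hg : Continuous g) (s : ℝ) :
    HasDerivAt (fun s => ∫ t in (0 : ℝ)..s, g t) (g s) s :=
  intervalIntegral.integral_hasDerivAt_right (hg.intervalIntegrable _ _)
    (hg.stronglyMeasurableAtFilter _ _) hg.continuousAt

theorem contDiff_integral_zero_to {g : ℝ → ℝ} (hg : ContDiff ℝ ∞ g) :
    ContDiff ℝ ∞ (fun s => ∫ t in (0 : ℝ)..s, g t) := by
  have hd : deriv (fun s => ∫ t in (0 : ℝ)..s, g t) = g :=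
    funext fun s => (integral_zero_to_hasDerivAt hg.continuous s).deriv
  rw [contDiff_infty_iff_deriv, hd]
  exact ⟨fun s => (integral_zero_to_hasDerivAt hg.continuous s).differentiableAt, hg⟩

theorem abs_integral_zero_to_sub_le {g : ℝ → ℝ} {M : ℝ} (hM : ∀ s, |g s| ≤ M)
    (hg : Measurable g) (s t : ℝ) :
    |(∫ r in (0 : ℝ)..s, g r) - ∫ r in (0 : ℝ)..t, g r| ≤ M * |s - t| := by
  have hi : ∀ a b, IntervalIntegrable g volume a b := fun a b =>
    (intervalIntegrable_const (c := M) (E := ℝ)).mono_fun hg.aestronglyMeasurable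
      (ae_of_all _ fun x => by simpa using (hM x).trans (le_abs_self M))
  rw [intervalIntegral.integral_interval_sub_left (hi _ _) (hi _ _)]
  exact intervalIntegral.norm_integral_le_of_norm_le_const (f := g) (C := M) fun x _ => hM x

/-- `g` is the pointwise limit of a uniformly bounded sequence of smooth functions. -/
def IsBoundedSmoothLimit (g : ℝ → ℝ) : Prop :=
  ∃ (γ : ℕ → ℝ → ℝ) (M : ℝ), (∀ j, ContDiff ℝ ∞ (γ j)) ∧ (∀ j s, |γ j s| ≤ M) ∧
    ∀ s, Tendsto (fun j => γ j s) atTop (𝓝 (g s))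

theorem IsBoundedSmoothLimit.measurable {g : ℝ → ℝ} (hg : IsBoundedSmoothLimit g) :
    Measurable g := by
  obtain ⟨γ, M, h1, -, h3⟩ := hg
  exact measurable_of_tendsto_metrizable (fun j => (h1 j).continuous.measurable)
    (tendsto_pi_nhds.2 h3)

theorem IsBoundedSmoothLimit.exists_bound {g : ℝ → ℝ} (hg : IsBoundedSmoothLimit g) :
    ∃ M, ∀ s, |g s| ≤ M := by
  obtain ⟨γ, M, -, h2, h3⟩ := hg
  exact ⟨M, fun s => le_of_tendsto (h3 s).abs (Eventually.of_forall fun j => h2 j s)⟩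

namespace HasGradW0

variable {p : ℝ} {v v' : EuclideanSpace ℝ (Fin N) → ℝ}
  {G G' : EuclideanSpace ℝ (Fin N) → EuclideanSpace ℝ (Fin N)}

theorem memLp_integral_comp {p : ℝ≥0∞} {μ : Measure (EuclideanSpace ℝ (Fin N))} {g : ℝ → ℝ}
    {M : ℝ} (hM : ∀ s, |g s| ≤ M) (hg : Measurable g) (hv : MemLp v p μ) :
    MemLp (fun x => ∫ t in (0 : ℝ)..v x, g t) p μ := by
  have hc : Continuous fun s => ∫ t in (0 : ℝ)..s, g t := by
    refine LipschitzWith.continuous (K := M.toNNReal) (LipschitzWith.of_dist_le_mul fun s t => ?_)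
    rw [Real.dist_eq, Real.dist_eq, Real.coe_toNNReal _ ((abs_nonneg _).trans (hM 0))]
    exact abs_integral_zero_to_sub_le hM hg s t
  refine hv.of_le_mul (c := M) (hc.comp_aestronglyMeasurable hv.1) (ae_of_all _ fun x => ?_)
  simpa using abs_integral_zero_to_sub_le hM hg (v x) 0

theorem memLp_comp_smul {p : ℝ≥0∞} {μ : Measure (EuclideanSpace ℝ (Fin N))} {g : ℝ → ℝ}
    {M : ℝ} (hM : ∀ s, |g s| ≤ M) (hg : Measurable g)
    (hv : AEStronglyMeasurable v μ) (hG : MemLp G p μ) :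
    MemLp (fun x => g (v x) • G x) p μ := by
  refine hG.of_le_mul (c := M) ((hg.comp_aemeasurable hv.aemeasurable).aestronglyMeasurable.smul
    hG.1) (ae_of_all _ fun x => ?_)
  rw [norm_smul]
  gcongr
  exact hM _

/-- Convergence of `g(v_n) ∇v_n` when `v_n → v` almost everywhere and in `W^{1,p}`. -/
theorem tendsto_comp_smul (hp : 1 ≤ p) {μ : Measure (EuclideanSpace ℝ (Fin N))} {g : ℝ → ℝ}
    {M : ℝ} (hM : ∀ s, |g s| ≤ M) (hg : Measurable g)
    {w : ℕ → EuclideanSpace ℝ (Fin N) → ℝ}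
    {H : ℕ → EuclideanSpace ℝ (Fin N) → EuclideanSpace ℝ (Fin N)}
    (hw : ∀ n, AEStronglyMeasurable (w n) μ) (hH : ∀ n, AEStronglyMeasurable (H n) μ)
    (hv : AEStronglyMeasurable v μ) (hG : MemLp G (ENNReal.ofReal p) μ)
    (hlim : ∀ᵐ x ∂μ, Tendsto (fun n => g (w n x) • G x) atTop (𝓝 (g (v x) • G x)))
    (hHG : Tendsto (fun n => eLpNorm (H n - G) (ENNReal.ofReal p) μ) atTop (𝓝 0)) :
    Tendsto (fun n => eLpNorm ((fun x => g (w n x) • H n x) - fun x => g (v x) • G x)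
      (ENNReal.ofReal p) μ) atTop (𝓝 0) := by
  have hP : 1 ≤ ENNReal.ofReal p := by simpa using ENNReal.ofReal_le_ofReal hp
  have mgw : ∀ n, AEStronglyMeasurable (fun x => g (w n x)) μ := fun n =>
    (hg.comp_aemeasurable (hw n).aemeasurable).aestronglyMeasurable
  have mgv : AEStronglyMeasurable (fun x => g (v x)) μ :=
    (hg.comp_aemeasurable hv.aemeasurable).aestronglyMeasurable
  -- The hypothesis `hlim` constrains g(w_n) only where G ≠ 0, so g may jump at values of v on whose
  -- level sets the gradient vanishes. The remaining error g(w_n)(H_n - G) is at most M ‖H_n - G‖.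
  have t1 : Tendsto (fun n => eLpNorm (fun x => g (w n x) • G x - g (v x) • G x)
      (ENNReal.ofReal p) μ) atTop (𝓝 0) := by
    refine tendsto_eLpNorm_zero_of_dominated (b := fun x => (M + M) * ‖G x‖) (by linarith)
      (fun n => ((mgw n).smul hG.1).sub (mgv.smul hG.1)) (hG.norm.const_mul _)
      (fun n => ae_of_all _ fun x => ?_) ?_
    · rw [← sub_smul, norm_smul]
      gcongr
      exact (norm_sub_le _ _).trans (add_le_add (hM _) (hM _))
    · filter_upwards [hlim] with x hx
      simpa using hx.sub_const (g (v x) • G x)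
  have t2 : Tendsto (fun n => ENNReal.ofReal M * eLpNorm (H n - G) (ENNReal.ofReal p) μ)
      atTop (𝓝 0) := by
    simpa using ENNReal.Tendsto.const_mul hHG (Or.inr ENNReal.ofReal_ne_top)
  have t3 := t2.add t1
  rw [add_zero] at t3
  refine tendsto_of_tendsto_of_tendsto_of_le_of_le tendsto_const_nhds t3 (fun _ => zero_le)
    fun n => ?_
  have e : ((fun x => g (w n x) • H n x) - fun x => g (v x) • G x) =
      (fun x => g (w n x) • (H n x - G x)) + (fun x => g (w n x) • G x - g (v x) • G x) := by
    ext1 x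
    simp [smul_sub]
  rw [e]
  refine (eLpNorm_add_le ((mgw n).smul ((hH n).sub hG.1))
    (((mgw n).smul hG.1).sub (mgv.smul hG.1)) hP).trans ?_
  refine add_le_add ?_ le_rfl
  refine eLpNorm_le_mul_of_norm_le (ae_of_all _ fun x => ?_)
  change ‖g (w n x) • (H n - G) x‖ ≤ _
  rw [norm_smul]
  gcongr
  exact hM _

theorem tendsto_integral_comp {p : ℝ≥0∞} {μ : Measure (EuclideanSpace ℝ (Fin N))} {g : ℝ → ℝ}
    {M : ℝ} (hM : ∀ s, |g s| ≤ M) (hg : Measurable g)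
    {w : ℕ → EuclideanSpace ℝ (Fin N) → ℝ}
    (hwv : Tendsto (fun n => eLpNorm (w n - v) p μ) atTop (𝓝 0)) :
    Tendsto (fun n => eLpNorm ((fun x => (∫ t in (0 : ℝ)..w n x, g t)) -
      fun x => ∫ t in (0 : ℝ)..v x, g t) p μ) atTop (𝓝 0) := by
  have h := ENNReal.Tendsto.const_mul (a := ENNReal.ofReal M) hwv
    (Or.inr ENNReal.ofReal_ne_top)
  rw [mul_zero] at h
  refine tendsto_of_tendsto_of_tendsto_of_le_of_le tendsto_const_nhds h
    (fun _ => zero_le) fun n => eLpNorm_le_mul_of_norm_le (ae_of_all _ fun x => ?_)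
  exact abs_integral_zero_to_sub_le hM hg _ _

/-- A smooth primitive vanishing at 0 sends test functions to test functions, for which the chain
rule is classical. The general case follows by closedness, along a subsequence of approximations
that converges a.e. -/
theorem integral_comp_of_contDiff (hp : 1 ≤ p) (h : HasGradW0 p Ω v G) {g : ℝ → ℝ} {M : ℝ}
    (hg : ContDiff ℝ ∞ g) (hM : ∀ s, |g s| ≤ M) :
    HasGradW0 p Ω (fun x => ∫ t in (0 : ℝ)..v x, g t) (fun x => g (v x) • G x) := by
  obtain ⟨ζ, hζ, h1, h2⟩ := h.exists_seq
  obtain ⟨σ, hσ, hae⟩ := exists_subseq_ae_tendsto (by linarith) (fun n => ((hζ n).memLp 1).1)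
    h.1.1 h1
  have hgm : Measurable g := hg.continuous.measurable
  refine of_tendsto hp (w := fun n => (fun s => ∫ t in (0 : ℝ)..s, g t) ∘ ζ (σ n))
    (H := fun n x => g (ζ (σ n) x) • gradient (ζ (σ n)) x) (fun n => ?_)
    (memLp_integral_comp hM hgm h.1) (memLp_comp_smul hM hgm h.1.1 h.2.1)
    (tendsto_integral_comp hM hgm (h1.comp hσ.tendsto_atTop))
    (tendsto_comp_smul hp hM hgm (fun n => ((hζ (σ n)).memLp 1).1)
      (fun n => ((hζ (σ n)).memLp_gradient 1).1) h.1.1 h.2.1 ?_ (h2.comp hσ.tendsto_atTop))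
  · rw [← (hζ (σ n)).gradient_comp fun s => integral_zero_to_hasDerivAt hg.continuous s]
    exact ((hζ (σ n)).comp (contDiff_integral_zero_to hg) (by simp)).hasGradW0 p
  · filter_upwards [hae] with x hx
    exact ((hg.continuous.tendsto _).comp hx).smul_const _

/-- The chain rule: `∇(∫_0^v g) = g(v) ∇v`. -/
theorem integral_comp (hp : 1 ≤ p) (h : HasGradW0 p Ω v G) {g : ℝ → ℝ}
    (hg : IsBoundedSmoothLimit g) :
    HasGradW0 p Ω (fun x => ∫ t in (0 : ℝ)..v x, g t) (fun x => g (v x) • G x) := by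
  have hgm := hg.measurable
  obtain ⟨γ, M, h1, h2, h3⟩ := hg
  have hM : ∀ s, |g s| ≤ M := fun s =>
    le_of_tendsto (h3 s).abs (Eventually.of_forall fun j => h2 j s)
  have lv := memLp_integral_comp hM hgm h.1
  have lG := memLp_comp_smul hM hgm h.1.1 h.2.1
  have lvj := fun j => memLp_integral_comp (h2 j) (h1 j).continuous.measurable h.1
  have lGj := fun j => memLp_comp_smul (h2 j) (h1 j).continuous.measurable h.1.1 h.2.1
  -- Here v and G are fixed and only the integrand varies, so dominated convergence with majorants
  -- 2M|v| and 2M‖G‖ suffices.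
  refine of_tendsto hp (fun j => h.integral_comp_of_contDiff hp (h1 j) (h2 j)) lv lG ?_ ?_
  · refine tendsto_eLpNorm_zero_of_dominated (b := fun x => (M + M) * ‖v x‖) (by linarith)
      (fun j => ((lvj j).sub lv).1) (h.1.norm.const_mul _) (fun j => ae_of_all _ fun x => ?_)
      (ae_of_all _ fun x => ?_)
    · have i1 := abs_integral_zero_to_sub_le (h2 j) (h1 j).continuous.measurable (v x) 0
      have i2 := abs_integral_zero_to_sub_le hM hgm (v x) 0
      simp only [intervalIntegral.integral_same, sub_zero] at i1 i2
      simp only [Pi.sub_apply, Real.norm_eq_abs]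
      rw [add_mul]
      exact (abs_sub _ _).trans (add_le_add i1 i2)
    · have : Tendsto (fun j => ∫ t in (0 : ℝ)..v x, γ j t) atTop
          (𝓝 (∫ t in (0 : ℝ)..v x, g t)) :=
        intervalIntegral.tendsto_integral_filter_of_dominated_convergence (fun _ => M)
          (Eventually.of_forall fun j => (h1 j).continuous.aestronglyMeasurable)
          (Eventually.of_forall fun j => ae_of_all _ fun t _ => h2 j t)
          intervalIntegrable_const (ae_of_all _ fun t _ => h3 t)
      simpa using this.sub_const (∫ t in (0 : ℝ)..v x, g t)
  · refine tendsto_eLpNorm_zero_of_dominated (b := fun x => (M + M) * ‖G x‖) (by linarith)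
      (fun j => ((lGj j).sub lG).1) (h.2.1.norm.const_mul _) (fun j => ae_of_all _ fun x => ?_)
      (ae_of_all _ fun x => ?_)
    · simp only [Pi.sub_apply, ← sub_smul, norm_smul]
      gcongr
      exact (norm_sub_le _ _).trans (add_le_add (h2 _ _) (hM _))
    · simpa using ((h3 (v x)).smul_const (G x)).sub_const (g (v x) • G x)

end HasGradW0

/-! ### Level sets and truncations -/

/-- The outer radius of every bump is exactly a while the inner radii increase to a, so the limit is
the indicator of the open interval at every point, ±a included. In the inner radius, j + 2 instead
of j + 1 keeps it positive at j = 0. -/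
theorem exists_smooth_bump_tendsto_indicator {a : ℝ} (ha : 0 < a) :
    ∃ θ : ℕ → ℝ → ℝ, (∀ j, ContDiff ℝ ∞ (θ j)) ∧ (∀ j s, θ j s ∈ Icc (0 : ℝ) 1) ∧
      (∀ j s, a ≤ |s| → θ j s = 0) ∧ ∀ s, |s| < a → ∀ᶠ j in atTop, θ j s = 1 := by
  have hin : ∀ j : ℕ, 0 < a * (1 - 1 / ((j : ℝ) + 2)) := fun j => by
    have : 1 / ((j : ℝ) + 2) < 1 := by
      rw [div_lt_one (by positivity)]; linarith [(Nat.cast_nonneg j : (0 : ℝ) ≤ j)]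
    exact mul_pos ha (by linarith)
  have hlt : ∀ j : ℕ, a * (1 - 1 / ((j : ℝ) + 2)) < a := fun j => by
    have : 0 < 1 / ((j : ℝ) + 2) := by positivity
    nlinarith
  let b : ℕ → ContDiffBump (0 : ℝ) := fun j => ⟨_, a, hin j, hlt j⟩
  refine ⟨fun j => b j, fun j => (b j).contDiff, fun j s => ⟨(b j).nonneg, (b j).le_one⟩,
    fun j s hs => (b j).zero_of_le_dist (by simpa using hs), fun s hs => ?_⟩
  have ht : Tendsto (fun j : ℕ => a * (1 - 1 / ((j : ℝ) + 2))) atTop (𝓝 (a * (1 - 0))) := by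
    refine (tendsto_const_nhds.sub ?_).const_mul a
    have := (tendsto_const_div_atTop_nhds_zero_nat (1 : ℝ)).comp (tendsto_add_atTop_nat 2)
    simpa [Function.comp_def] using this
  filter_upwards [ht.eventually (lt_mem_nhds (by simpa using hs))] with j hj
  exact (b j).one_of_mem_closedBall (mem_closedBall_zero_iff.2 hj.le)

/-- Cutting off a smooth function outside `(-a, a)`. -/
theorem isBoundedSmoothLimit_indicator {a : ℝ} (ha : 0 < a) {g : ℝ → ℝ} (hg : ContDiff ℝ ∞ g) :
    IsBoundedSmoothLimit (indicator {s | |s| < a} g) := by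
  obtain ⟨θ, h1, h2, h3, h4⟩ := exists_smooth_bump_tendsto_indicator ha
  obtain ⟨M, hM⟩ := (isCompact_Icc (a := -a) (b := a)).exists_bound_of_continuousOn
    hg.continuous.continuousOn
  refine ⟨fun j s => θ j s * g s, M, fun j => (h1 j).mul hg, fun j s => ?_, fun s => ?_⟩
  · change |θ j s * g s| ≤ M
    rcases le_or_gt a |s| with h | h
    · rw [h3 j s h]
      simpa using (norm_nonneg _).trans (hM 0 (by simp [ha.le]))
    · rw [abs_mul, abs_of_nonneg (h2 j s).1, ← one_mul M]
      have := hM s ⟨by linarith [(abs_lt.1 h).1], (abs_lt.1 h).2.le⟩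
      exact mul_le_mul (h2 j s).2 this (abs_nonneg _) zero_le_one
  · rcases le_or_gt a |s| with h | h
    · simp [h3 _ s h, h]
    · rw [indicator_of_mem (by exact h)]
      refine tendsto_const_nhds.congr' ?_
      filter_upwards [h4 s h] with j hj
      rw [hj, one_mul]

theorem isBoundedSmoothLimit_indicator_singleton (a : ℝ) :
    IsBoundedSmoothLimit (indicator {a} fun _ => (1 : ℝ)) := by
  let b : ℕ → ContDiffBump a := fun j => ⟨1 / (2 * ((j : ℝ) + 1)), 1 / ((j : ℝ) + 1),
    by positivity, by
      apply one_div_lt_one_div_of_lt <;> linarith [(Nat.cast_nonneg j : (0 : ℝ) ≤ j)]⟩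
  refine ⟨fun j => b j, 1, fun j => (b j).contDiff,
    fun j s => by rw [abs_of_nonneg (b j).nonneg]; exact (b j).le_one, fun s => ?_⟩
  rcases eq_or_ne s a with rfl | h
  · simp only [mem_singleton_iff, indicator_of_mem]
    refine tendsto_const_nhds.congr fun j => ?_
    exact ((b j).one_of_mem_closedBall (by simp; positivity)).symm
  · rw [indicator_of_notMem (by simpa using h)]
    refine tendsto_const_nhds.congr' ?_
    have hd : 0 < dist s a := dist_pos.2 h
    filter_upwards [tendsto_one_div_add_atTop_nhds_zero_nat.eventually (gt_mem_nhds hd)] with j hj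
    exact ((b j).zero_of_le_dist hj.le).symm

/-- The gradient vanishes almost everywhere on level sets. -/
theorem HasGradW0.ae_eq_zero_of_eq [IsFiniteMeasure (volume.restrict Ω)] (hΩ : IsOpen Ω)
    {p : ℝ} (hp : 1 ≤ p) {v : EuclideanSpace ℝ (Fin N) → ℝ}
    {G : EuclideanSpace ℝ (Fin N) → EuclideanSpace ℝ (Fin N)} (h : HasGradW0 p Ω v G) (a : ℝ) :
    ∀ᵐ x ∂(volume.restrict Ω), v x = a → G x = 0 := by
  have h1 := h.integral_comp hp (isBoundedSmoothLimit_indicator_singleton a)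
  -- The indicator of a point has primitive zero, yet the chain rule assigns to this primitive the
  -- gradient χ_{v = a} G. By uniqueness of the gradient, the latter vanishes a.e.
  have e : (fun x => ∫ t in (0 : ℝ)..v x, indicator {a} (fun _ => (1 : ℝ)) t) = 0 := by
    ext1 x
    refine intervalIntegral.integral_zero_ae ?_
    filter_upwards [Measure.ae_ne volume a] with t ht _
    exact indicator_of_notMem (by simpa using ht) _
  rw [e] at h1
  have h2 := IsTest.zero.hasGradW0 (Ω := Ω) p
  filter_upwards [h1.ae_unique hΩ hp h2] with x hx hva
  rw [hva] at hx
  simpa [gradient_eq_comp] using hx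

/-! ### Sobolev inequality in `W^{1,p}_0` -/

theorem HasGradW0.sub {p : ℝ} (hp : 1 ≤ p) {v w : EuclideanSpace ℝ (Fin N) → ℝ}
    {G H : EuclideanSpace ℝ (Fin N) → EuclideanSpace ℝ (Fin N)}
    (hv : HasGradW0 p Ω v G) (hw : HasGradW0 p Ω w H) : HasGradW0 p Ω (v - w) (G - H) := by
  have hP : 1 ≤ ENNReal.ofReal p := by simpa using ENNReal.ofReal_le_ofReal hp
  refine ⟨hv.1.sub hw.1, hv.2.1.sub hw.2.1, fun ε hε => ?_⟩
  have hε2 : 0 < ε / 2 := ENNReal.half_pos hε.ne'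
  obtain ⟨ζ, hζ, h1, h2⟩ := hv.2.2 _ hε2
  obtain ⟨η, hη, h3, h4⟩ := hw.2.2 _ hε2
  refine ⟨ζ + (-1 : ℝ) • η, hζ.add (hη.smul _), ?_, ?_⟩
  · have e : v - w - (ζ + (-1 : ℝ) • η) = (v - ζ) - (w - η) := by rw [neg_one_smul]; abel
    rw [e, ← ENNReal.add_halves ε]
    exact (eLpNorm_sub_le (hv.1.1.sub (hζ.memLp 1).1) (hw.1.1.sub (hη.memLp 1).1) hP).trans_lt
      (ENNReal.add_lt_add h1 h3)
  · have e : G - H - gradient (ζ + (-1 : ℝ) • η) = (G - gradient ζ) - (H - gradient η) := by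
      rw [hζ.gradient_add (hη.smul _), hη.gradient_smul, neg_one_smul]; abel
    rw [e, ← ENNReal.add_halves ε]
    exact (eLpNorm_sub_le (hv.2.1.1.sub (hζ.memLp_gradient 1).1)
      (hw.2.1.1.sub (hη.memLp_gradient 1).1) hP).trans_lt (ENNReal.add_lt_add h2 h4)

/-- The Sobolev inequality needs a gradient exponent t in [1, N). For p < N, t = p works. For p = N,
the exponent sN/(s + N), whose Sobolev conjugate is s, is below N; it is raised to 1 if necessary.
-/
theorem exists_sobolev_exponent (hN : 2 ≤ N) {p : ℝ} (hp : 1 ≤ p) (hpN : p ≤ N) {s : ℝ}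
    (hs : 0 < s) (hsp : p < N → s < N * p / (N - p)) :
    ∃ t : ℝ, 1 ≤ t ∧ t ≤ p ∧ t < N ∧ t⁻¹ - (N : ℝ)⁻¹ ≤ s⁻¹ := by
  have hN' : (2 : ℝ) ≤ N := by exact_mod_cast hN
  rcases hpN.lt_or_eq with h | h
  · refine ⟨p, hp, le_rfl, h, ?_⟩
    have e : p⁻¹ - (N : ℝ)⁻¹ = (N * p / (N - p))⁻¹ := by
      have : (N : ℝ) - p ≠ 0 := by linarith
      field_simp
    rw [e]
    exact inv_anti₀ hs (hsp h).le
  · have h1 : s * N / (s + N) < N := by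
      rw [div_lt_iff₀ (by linarith)]; nlinarith
    refine ⟨max 1 (s * N / (s + N)), le_max_left _ _, ?_, ?_, ?_⟩
    · rw [h]; exact max_le (by linarith) h1.le
    · exact max_lt (by linarith) h1
    · have h2 : (max 1 (s * N / (s + N)))⁻¹ ≤ (s * N / (s + N))⁻¹ :=
        inv_anti₀ (by positivity) (le_max_right _ _)
      have h3 : (s * N / (s + N))⁻¹ = s⁻¹ + (N : ℝ)⁻¹ := by
        field_simp; ring
      linarith

/-- The Gagliardo–Nirenberg–Sobolev inequality is applied at an exponent t ≤ p; Hölder's inequality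
on the bounded set then replaces ‖∇ζ‖_t by ‖∇ζ‖_p. -/
theorem IsTest.sobolev (hΩb : Bornology.IsBounded Ω) (hN : 2 ≤ N) {p : ℝ} (hp : 1 ≤ p)
    (hpN : p ≤ N) {s : ℝ} (hs : 0 < s) (hsp : p < N → s < N * p / (N - p)) :
    ∃ C : ℝ≥0, ∀ ζ, IsTest Ω ζ →
      eLpNorm ζ (ENNReal.ofReal s) (volume.restrict Ω) ≤
        C * eLpNorm (gradient ζ) (ENNReal.ofReal p) (volume.restrict Ω) := by
  have := isFiniteMeasure_restrict_of_isBounded hΩb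
  obtain ⟨t, ht1, htp, htN, hts⟩ := exists_sobolev_exponent hN hp hpN hs hsp
  have hle : ENNReal.ofReal t ≤ ENNReal.ofReal p := ENNReal.ofReal_le_ofReal htp
  have hc : volume.restrict Ω univ ^
      (1 / (ENNReal.ofReal t).toReal - 1 / (ENNReal.ofReal p).toReal) ≠ ⊤ := by
    refine ENNReal.rpow_ne_top_of_nonneg ?_ (measure_ne_top _ _)
    rw [ENNReal.toReal_ofReal (by linarith), ENNReal.toReal_ofReal (by linarith), sub_nonneg]
    exact one_div_le_one_div_of_le (by linarith) htp
  lift volume.restrict Ω univ ^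
      (1 / (ENNReal.ofReal t).toReal - 1 / (ENNReal.ofReal p).toReal) to ℝ≥0 using hc with c hcc
  refine ⟨eLpNormLESNormFDerivOfLeConst ℝ (volume : Measure (EuclideanSpace ℝ (Fin N))) Ω
    t.toNNReal s.toNNReal * c, fun ζ hζ => ?_⟩
  have h1 := eLpNorm_le_eLpNorm_fderiv_of_le
    (volume : Measure (EuclideanSpace ℝ (Fin N))) (u := ζ) (s := Ω)
    (hζ.1.of_le (by exact_mod_cast le_top)) hζ.support_subset (p := t.toNNReal) (q := s.toNNReal)
    (by simpa using ht1)
    (by rw [finrank_euclideanSpace_fin, ← NNReal.coe_lt_coe, Real.coe_toNNReal _ (by linarith)]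
        simpa using htN)
    (by rw [finrank_euclideanSpace_fin, NNReal.coe_inv, Real.coe_toNNReal _ hs.le,
          Real.coe_toNNReal _ (by linarith)]
        exact hts) hΩb
  have e : eLpNorm (fderiv ℝ ζ) (t.toNNReal) volume =
      eLpNorm (gradient ζ) (ENNReal.ofReal t) volume :=
    eLpNorm_congr_norm_ae (ae_of_all _ fun x => (norm_gradient ζ x).symm)
  rw [hζ.eLpNorm_restrict]
  refine h1.trans ?_
  rw [e, ← hζ.eLpNorm_gradient_restrict, ENNReal.coe_mul, mul_assoc]
  gcongr
  rw [mul_comm, hcc]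
  exact eLpNorm_le_eLpNorm_mul_rpow_measure_univ hle (hζ.memLp_gradient 1).1

/-- Fatou's lemma along an a.e. convergent subsequence of test functions carries the inequality
over, without knowing beforehand that v is in L^s. -/
theorem HasGradW0.sobolev (hΩb : Bornology.IsBounded Ω) (hN : 2 ≤ N) {p : ℝ} (hp : 1 ≤ p)
    (hpN : p ≤ N) {s : ℝ} (hs : 0 < s) (hsp : p < N → s < N * p / (N - p)) :
    ∃ C : ℝ≥0, ∀ v G, HasGradW0 p Ω v G →
      eLpNorm v (ENNReal.ofReal s) (volume.restrict Ω) ≤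
        C * eLpNorm G (ENNReal.ofReal p) (volume.restrict Ω) := by
  have hP : 1 ≤ ENNReal.ofReal p := by simpa using ENNReal.ofReal_le_ofReal hp
  obtain ⟨C, hC⟩ := IsTest.sobolev hΩb hN hp hpN hs hsp
  refine ⟨C, fun v G h => ?_⟩
  obtain ⟨ζ, hζ, h1, h2⟩ := h.exists_seq
  obtain ⟨σ, hσ, hae⟩ := exists_subseq_ae_tendsto (by linarith) (fun n => ((hζ n).memLp 1).1)
    h.1.1 h1
  have hb : Tendsto (fun n => C * (eLpNorm (gradient (ζ (σ n)) - G) (ENNReal.ofReal p)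
      (volume.restrict Ω) + eLpNorm G (ENNReal.ofReal p) (volume.restrict Ω))) atTop
      (𝓝 (C * eLpNorm G (ENNReal.ofReal p) (volume.restrict Ω))) := by
    have := (h2.comp hσ.tendsto_atTop).add_const
      (eLpNorm G (ENNReal.ofReal p) (volume.restrict Ω))
    rw [zero_add] at this
    exact ENNReal.Tendsto.const_mul this (Or.inr ENNReal.coe_ne_top)
  refine (Lp.eLpNorm_lim_le_liminf_eLpNorm (fun n => ((hζ (σ n)).memLp 1).1) v hae).trans ?_
  rw [← hb.liminf_eq]
  refine liminf_le_liminf (Eventually.of_forall fun n => (hC _ (hζ (σ n))).trans ?_)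
  gcongr
  have e : gradient (ζ (σ n)) = (gradient (ζ (σ n)) - G) + G := by abel
  conv_lhs => rw [e]
  exact eLpNorm_add_le (((hζ (σ n)).memLp_gradient 1).1.sub h.2.1.1) h.2.1.1 hP

/-! ### Rellich's compactness theorem in `L^1` -/

/-- `‖ζ(· - y) - ζ‖₁ ≤ |y| ‖∇ζ‖₁`. -/
theorem IsTest.lintegral_translate_le {ζ : EuclideanSpace ℝ (Fin N) → ℝ} (hζ : IsTest Ω ζ)
    (y : EuclideanSpace ℝ (Fin N)) :
    ∫⁻ x, ‖ζ (x - y) - ζ x‖ₑ ≤ ‖y‖ₑ * ∫⁻ x, ‖gradient ζ x‖ₑ := by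
  have hpt : ∀ x, ‖ζ (x - y) - ζ x‖ₑ ≤
      ‖y‖ₑ * ∫⁻ t in Ioc (0 : ℝ) 1, ‖gradient ζ (x - t • y)‖ₑ := fun x => by
    -- The difference is the integral of the derivative along the segment from x to x - y. After
    -- Tonelli, translation invariance makes the inner integral independent of t.
    have hd : ∀ t ∈ uIcc (0 : ℝ) 1, HasDerivAt (fun t : ℝ => ζ (x - t • y))
        (fderiv ℝ ζ (x - t • y) (-y)) t := fun t _ => by
      have h1 : HasDerivAt (fun t : ℝ => x - t • y) (-y) t := by
        simpa using ((hasDerivAt_id t).smul_const y).const_sub x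
      exact (hζ.differentiable _).hasFDerivAt.comp_hasDerivAt t h1
    have hc : Continuous fun t : ℝ => fderiv ℝ ζ (x - t • y) (-y) :=
      (hζ.continuous_fderiv.comp (by fun_prop)).clm_apply continuous_const
    have h2 := intervalIntegral.integral_eq_sub_of_hasDerivAt hd (hc.intervalIntegrable _ _)
    simp only [one_smul, zero_smul, sub_zero] at h2
    rw [← h2, intervalIntegral.integral_of_le zero_le_one]
    refine (enorm_integral_le_lintegral_enorm _).trans ?_
    rw [← lintegral_const_mul' _ _ enorm_ne_top]
    refine lintegral_mono fun t => ?_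
    rw [← ofReal_norm, ← ofReal_norm, ← ofReal_norm, ← ENNReal.ofReal_mul (norm_nonneg _),
      norm_gradient, mul_comm ‖y‖]
    refine ENNReal.ofReal_le_ofReal ?_
    simpa using (fderiv ℝ ζ (x - t • y)).le_opNorm (-y)
  have hcont : Continuous fun z : EuclideanSpace ℝ (Fin N) × ℝ =>
      ‖gradient ζ (z.1 - z.2 • y)‖ₑ :=
    (hζ.continuous_gradient.comp (by fun_prop)).enorm
  calc ∫⁻ x, ‖ζ (x - y) - ζ x‖ₑ
      ≤ ∫⁻ x, ‖y‖ₑ * ∫⁻ t in Ioc (0 : ℝ) 1, ‖gradient ζ (x - t • y)‖ₑ := lintegral_mono hpt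
    _ = ‖y‖ₑ * ∫⁻ t in Ioc (0 : ℝ) 1, ∫⁻ x, ‖gradient ζ (x - t • y)‖ₑ := by
        rw [lintegral_const_mul' _ _ enorm_ne_top, lintegral_lintegral_swap]
        exact hcont.measurable.aemeasurable
    _ = ‖y‖ₑ * ∫⁻ x, ‖gradient ζ x‖ₑ := by
        congr 1
        have : ∀ t : ℝ, ∫⁻ x, ‖gradient ζ (x - t • y)‖ₑ = ∫⁻ x, ‖gradient ζ x‖ₑ := fun t =>
          lintegral_sub_right_eq_self (fun x => ‖gradient ζ x‖ₑ) (t • y)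
        simp_rw [this]
        simp

/-- Approximation by averages over small balls. -/
theorem IsTest.lintegral_sub_average_le {ζ : EuclideanSpace ℝ (Fin N) → ℝ} (hζ : IsTest Ω ζ)
    {ρ : EuclideanSpace ℝ (Fin N) → ℝ} (hρc : Continuous ρ) {h : ℝ}
    (hρs : ∀ y, h < ‖y‖ → ρ y = 0) (hρ0 : ∀ y, 0 ≤ ρ y) (hρi : Integrable ρ)
    (hρ1 : ∫ y, ρ y = 1) :
    ∫⁻ x, ‖(∫ y, ρ (x - y) * ζ y) - ζ x‖ₑ ≤ ENNReal.ofReal h * ∫⁻ x, ‖gradient ζ x‖ₑ := by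
  have hpt : ∀ x, ‖(∫ y, ρ (x - y) * ζ y) - ζ x‖ₑ ≤ ∫⁻ y, ‖ρ y‖ₑ * ‖ζ (x - y) - ζ x‖ₑ :=
    fun x => by
    have e1 : ∫ y, ρ (x - y) * ζ y = ∫ y, ρ y * ζ (x - y) := by
      rw [← integral_sub_left_eq_self _ _ x]
      simp
    have e2 : ζ x = ∫ y, ρ y * ζ x := by rw [integral_mul_const, hρ1, one_mul]
    obtain ⟨M, -, hM⟩ := hζ.exists_bound
    have i1 : Integrable fun y => ρ y * ζ (x - y) :=
      hρi.mul_bdd (c := M) (hζ.continuous.comp (by fun_prop)).aestronglyMeasurable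
        (ae_of_all _ fun y => (hM _).1)
    rw [e1]
    nth_rw 1 [e2]
    rw [← integral_sub i1 (hρi.mul_const _)]
    refine (enorm_integral_le_lintegral_enorm _).trans (lintegral_mono fun y => ?_)
    rw [← mul_sub, enorm_mul]
  have hcont : Continuous fun z : EuclideanSpace ℝ (Fin N) × EuclideanSpace ℝ (Fin N) =>
      ‖ρ z.2‖ₑ * ‖ζ (z.1 - z.2) - ζ z.1‖ₑ := by
    have h1 : Continuous fun z : EuclideanSpace ℝ (Fin N) × EuclideanSpace ℝ (Fin N) =>
        ‖ρ z.2 * (ζ (z.1 - z.2) - ζ z.1)‖ₑ :=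
      ((hρc.comp continuous_snd).mul ((hζ.continuous.comp (by fun_prop)).sub
        (hζ.continuous.comp continuous_fst))).enorm
    simpa only [enorm_mul] using h1
  calc ∫⁻ x, ‖(∫ y, ρ (x - y) * ζ y) - ζ x‖ₑ
      ≤ ∫⁻ x, ∫⁻ y, ‖ρ y‖ₑ * ‖ζ (x - y) - ζ x‖ₑ := lintegral_mono hpt
    _ = ∫⁻ y, ‖ρ y‖ₑ * ∫⁻ x, ‖ζ (x - y) - ζ x‖ₑ := by
        rw [lintegral_lintegral_swap hcont.measurable.aemeasurable]
        simp_rw [lintegral_const_mul' _ _ enorm_ne_top]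
    _ ≤ ∫⁻ y, ‖ρ y‖ₑ * (ENNReal.ofReal h * ∫⁻ x, ‖gradient ζ x‖ₑ) := by
        refine lintegral_mono fun y => ?_
        rcases le_or_gt ‖y‖ h with hy | hy
        · gcongr
          refine (hζ.lintegral_translate_le y).trans ?_
          gcongr
          rw [← ofReal_norm]
          exact ENNReal.ofReal_le_ofReal hy
        · simp [hρs y hy]
    _ = ENNReal.ofReal h * ∫⁻ x, ‖gradient ζ x‖ₑ := by
        rw [lintegral_mul_const _ hρc.enorm.measurable,
          ← ofReal_integral_norm_eq_lintegral_enorm hρi]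
        simp_rw [Real.norm_eq_abs, abs_of_nonneg (hρ0 _), hρ1]
        simp

/-- A uniformly bounded, uniformly Lipschitz sequence has finite sup-norm nets on compact sets. -/
theorem exists_finite_net_of_lipschitz {X : Type*} [PseudoMetricSpace X] {K : Set X}
    (hK : IsCompact K) {f : ℕ → X → ℝ} {A : ℝ} {L : ℝ≥0} (hA : ∀ n, ∀ x ∈ K, |f n x| ≤ A)
    (hL : ∀ n, LipschitzWith L (f n)) {ε : ℝ} (hε : 0 < ε) :
    ∃ t : Finset ℕ, ∀ n, ∃ m ∈ t, ∀ x ∈ K, |f n x - f m x| ≤ ε := by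
  have : CompactSpace K := isCompact_iff_compactSpace.1 hK
  let F : ℕ → BoundedContinuousFunction K ℝ := fun n =>
    BoundedContinuousFunction.mkOfCompact ⟨fun x => f n x, by
      exact (hL n).continuous.comp continuous_subtype_val⟩
  have hF : IsCompact (closure (range F)) := by
    refine BoundedContinuousFunction.arzela_ascoli (Icc (-A) A) isCompact_Icc (range F) ?_ ?_
    · rintro _ x ⟨n, rfl⟩
      exact abs_le.1 (hA n x x.2)
    · refine (LipschitzWith.uniformEquicontinuous (K := L) _ ?_).equicontinuous
      rintro ⟨_, n, rfl⟩
      exact ((hL n).comp (LipschitzWith.subtype_val K)).weaken (by simp)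
  obtain ⟨t, ht, htf, hcov⟩ :=
    Metric.finite_approx_of_totallyBounded (hF.totallyBounded.subset subset_closure) ε hε
  have ht' : ∀ y ∈ t, ∃ n, F n = y := fun y hy => ht hy
  choose! κ hκ using ht'
  refine ⟨htf.toFinset.image κ, fun n => ?_⟩
  obtain ⟨y, hy, hny⟩ := mem_iUnion₂.1 (hcov (mem_range_self n))
  refine ⟨κ y, Finset.mem_image_of_mem _ (htf.mem_toFinset.2 hy), fun x hx => ?_⟩
  rw [← hκ y hy] at hny
  exact (BoundedContinuousFunction.dist_coe_le_dist (f := F n) (g := F (κ y)) ⟨x, hx⟩).trans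
    (Metric.mem_ball.1 hny).le

/-- Sequences of test functions with bounded gradients have finite `L^1` nets. -/
theorem exists_finite_net_of_isTest (hΩb : Bornology.IsBounded Ω)
    {ζ : ℕ → EuclideanSpace ℝ (Fin N) → ℝ} (hζ : ∀ n, IsTest Ω (ζ n)) {C : ℝ≥0}
    (h1 : ∀ n, ∫⁻ x, ‖ζ n x‖ₑ ≤ C) (h2 : ∀ n, ∫⁻ x, ‖gradient (ζ n) x‖ₑ ≤ C)
    {ε : ℝ} (hε : 0 < ε) :
    ∃ t : Finset ℕ, ∀ n, ∃ m ∈ t, ∫⁻ x in Ω, ‖ζ n x - ζ m x‖ₑ ≤ ENNReal.ofReal ε := by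
  have := isFiniteMeasure_restrict_of_isBounded hΩb
  -- At this scale mollification costs at most hC ≤ ε/3 in L^1, uniformly in n. With h now fixed,
  -- the mollified functions are uniformly bounded and uniformly Lipschitz, so Arzelà–Ascoli
  -- provides a finite net. The uniform tolerance ε/(3(m + 1)) on it costs another ε/3 after
  -- integration over Ω, which has measure m.
  set h : ℝ := ε / (3 * (C + 1)) with hh
  have hh0 : 0 < h := by positivity
  let b : ContDiffBump (0 : EuclideanSpace ℝ (Fin N)) := ⟨h / 2, h, by positivity, by linarith⟩
  set ρ := b.normed volume with hρ
  have hρcd : ContDiff ℝ 1 ρ := b.contDiff_normed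
  have hρc : Continuous ρ := hρcd.continuous
  have hρs : HasCompactSupport ρ := b.hasCompactSupport_normed
  obtain ⟨L, hL⟩ := hρcd.lipschitzWith_of_hasCompactSupport hρs (by simp)
  obtain ⟨A, hA⟩ := hρs.exists_bound_of_continuous hρc
  have iζ : ∀ n, Integrable (ζ n) := fun n =>
    (hζ n).continuous.integrable_of_hasCompactSupport (hζ n).2.1
  have nζ : ∀ n, ∫ x, ‖ζ n x‖ ≤ C := fun n => by
    rw [integral_norm_eq_lintegral_enorm (iζ n).1]
    exact ENNReal.toReal_le_coe_of_le_coe (h1 n)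
  have iρζ : ∀ n x, Integrable fun y => ρ (x - y) * ζ n y := fun n x =>
    (iζ n).bdd_mul (c := A) (hρc.comp (by fun_prop)).aestronglyMeasurable (ae_of_all _ fun y => hA _)
  let f : ℕ → EuclideanSpace ℝ (Fin N) → ℝ := fun n x => ∫ y, ρ (x - y) * ζ n y
  have hfA : ∀ n x, |f n x| ≤ A * C := fun n x => by
    change ‖∫ y, ρ (x - y) * ζ n y‖ ≤ _
    refine (norm_integral_le_of_norm_le ((iζ n).norm.const_mul A)
      (ae_of_all _ fun y => ?_)).trans ?_
    · rw [norm_mul]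
      gcongr
      exact hA _
    · rw [integral_const_mul]
      gcongr
      · exact (norm_nonneg _).trans (hA 0)
      · exact nζ n
  have hfL : ∀ n, LipschitzWith (L * C) (f n) := fun n => by
    refine LipschitzWith.of_dist_le_mul fun x x' => ?_
    rw [dist_eq_norm, ← integral_sub (iρζ n x) (iρζ n x')]
    refine (norm_integral_le_of_norm_le ((iζ n).norm.const_mul (L * dist x x'))
      (ae_of_all _ fun y => ?_)).trans ?_
    · rw [← sub_mul, norm_mul]
      gcongr
      rw [← dist_eq_norm]
      simpa using hL.dist_le_mul (x - y) (x' - y)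
    · rw [integral_const_mul]
      push_cast
      calc (L : ℝ) * dist x x' * ∫ y, ‖ζ n y‖ ≤ L * dist x x' * C := by gcongr; exact nζ n
        _ = L * C * dist x x' := by ring
  have hclose : ∀ n, ∫⁻ x in Ω, ‖f n x - ζ n x‖ₑ ≤ ENNReal.ofReal (ε / 3) := fun n => by
    refine (setLIntegral_le_lintegral _ _).trans (((hζ n).lintegral_sub_average_le hρc (h := h)
      (fun y hy => ?_) b.nonneg_normed b.integrable_normed b.integral_normed).trans ?_)
    · have : y ∉ Function.support ρ := by
        rw [hρ, b.support_normed_eq]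
        simpa [b] using hy.le
      simpa using this
    · calc ENNReal.ofReal h * ∫⁻ x, ‖gradient (ζ n) x‖ₑ ≤ ENNReal.ofReal h * C := by
            gcongr; exact h2 n
        _ = ENNReal.ofReal (h * C) := by
            rw [ENNReal.ofReal_mul hh0.le, ENNReal.ofReal_coe_nnreal]
        _ ≤ ENNReal.ofReal (ε / 3) := by
            refine ENNReal.ofReal_le_ofReal ?_
            rw [hh, div_mul_eq_mul_div, div_le_div_iff₀ (by positivity) (by norm_num)]
            nlinarith [C.2]
  set m := (volume.restrict Ω).real univ with hm
  have hm0 : 0 ≤ m := measureReal_nonneg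
  obtain ⟨t, ht⟩ := exists_finite_net_of_lipschitz (K := closure Ω)
    hΩb.isCompact_closure (fun n x _ => hfA n x) hfL
    (ε := ε / (3 * (m + 1))) (by positivity)
  refine ⟨t, fun n => ?_⟩
  obtain ⟨k, hk, hkn⟩ := ht n
  refine ⟨k, hk, ?_⟩
  have mid : ∫⁻ x in Ω, ‖f n x - f k x‖ₑ ≤ ENNReal.ofReal (ε / 3) := by
    calc ∫⁻ x in Ω, ‖f n x - f k x‖ₑ
        ≤ ∫⁻ _ in Ω, ENNReal.ofReal (ε / (3 * (m + 1))) := by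
          refine setLIntegral_mono measurable_const fun x hx => ?_
          rw [← ofReal_norm]
          exact ENNReal.ofReal_le_ofReal (hkn x (subset_closure hx))
      _ = ENNReal.ofReal (ε / (3 * (m + 1)) * m) := by
          rw [lintegral_const, ENNReal.ofReal_mul (by positivity), hm, ofReal_measureReal]
      _ ≤ _ := by
          refine ENNReal.ofReal_le_ofReal ?_
          rw [div_mul_eq_mul_div, div_le_div_iff₀ (by positivity) (by norm_num)]
          nlinarith
  have mf : ∀ n, Measurable (f n) := fun n => (hfL n).continuous.measurable
  have mζ : ∀ n, Measurable (ζ n) := fun n => (hζ n).continuous.measurable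
  calc ∫⁻ x in Ω, ‖ζ n x - ζ k x‖ₑ
      ≤ ∫⁻ x in Ω, (‖f n x - ζ n x‖ₑ + (‖f n x - f k x‖ₑ + ‖f k x - ζ k x‖ₑ)) := by
        refine lintegral_mono fun x => ?_
        have e : ζ n x - ζ k x = -(f n x - ζ n x) + ((f n x - f k x) + (f k x - ζ k x)) := by
          ring
        rw [e]
        refine (enorm_add_le _ _).trans ?_
        rw [enorm_neg]
        gcongr
        exact enorm_add_le _ _
    _ = (∫⁻ x in Ω, ‖f n x - ζ n x‖ₑ) + ((∫⁻ x in Ω, ‖f n x - f k x‖ₑ) +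
          ∫⁻ x in Ω, ‖f k x - ζ k x‖ₑ) := by
        have m1 : Measurable fun x => ‖f n x - ζ n x‖ₑ := ((mf n).sub (mζ n)).enorm
        have m2 : Measurable fun x => ‖f n x - f k x‖ₑ := ((mf n).sub (mf k)).enorm
        rw [lintegral_add_left m1, lintegral_add_left m2]
    _ ≤ ENNReal.ofReal (ε / 3) + (ENNReal.ofReal (ε / 3) + ENNReal.ofReal (ε / 3)) :=
        add_le_add (hclose n) (add_le_add mid (hclose k))
    _ = ENNReal.ofReal ε := by
        rw [← ENNReal.ofReal_add (by positivity) (by positivity),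
          ← ENNReal.ofReal_add (by positivity) (by positivity)]
        congr 1
        ring

/-- Rellich's theorem for test functions. -/
theorem exists_subseq_tendsto_of_isTest (hΩb : Bornology.IsBounded Ω)
    {ζ : ℕ → EuclideanSpace ℝ (Fin N) → ℝ} (hζ : ∀ n, IsTest Ω (ζ n)) {C : ℝ≥0}
    (h1 : ∀ n, eLpNorm (ζ n) 1 (volume.restrict Ω) ≤ C)
    (h2 : ∀ n, eLpNorm (gradient (ζ n)) 1 (volume.restrict Ω) ≤ C) :
    ∃ (v : EuclideanSpace ℝ (Fin N) → ℝ) (σ : ℕ → ℕ), StrictMono σ ∧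
      MemLp v 1 (volume.restrict Ω) ∧
      Tendsto (fun n => eLpNorm (ζ (σ n) - v) 1 (volume.restrict Ω)) atTop (𝓝 0) := by
  have h1' : ∀ n, ∫⁻ x, ‖ζ n x‖ₑ ≤ C := fun n => by
    rw [← eLpNorm_one_eq_lintegral_enorm, ← (hζ n).eLpNorm_restrict]; exact h1 n
  have h2' : ∀ n, ∫⁻ x, ‖gradient (ζ n) x‖ₑ ≤ C := fun n => by
    rw [← eLpNorm_one_eq_lintegral_enorm, ← (hζ n).eLpNorm_gradient_restrict]; exact h2 n
  let Z : ℕ → Lp ℝ 1 (volume.restrict Ω) := fun n => ((hζ n).memLp 1).toLp (ζ n)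
  have htb : TotallyBounded (range Z) := by
    rw [Metric.totallyBounded_iff]
    intro ε hε
    obtain ⟨t, ht⟩ := exists_finite_net_of_isTest hΩb hζ h1' h2' (half_pos hε)
    refine ⟨Z '' t, t.finite_toSet.image _, ?_⟩
    rintro _ ⟨n, rfl⟩
    obtain ⟨m, hm, hnm⟩ := ht n
    refine mem_iUnion₂.2 ⟨Z m, mem_image_of_mem _ hm, ?_⟩
    rw [Metric.mem_ball, Lp.dist_def, eLpNorm_congr_ae
      ((((hζ n).memLp 1).coeFn_toLp).sub (((hζ m).memLp 1).coeFn_toLp)),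
      eLpNorm_one_eq_lintegral_enorm]
    refine (ENNReal.toReal_le_of_le_ofReal (by positivity) hnm).trans_lt (by linarith)
  have hcpt : IsCompact (closure (range Z)) := htb.closure.isCompact_of_isClosed isClosed_closure
  obtain ⟨v, -, σ, hσ, hlim⟩ := hcpt.tendsto_subseq fun n => subset_closure (mem_range_self n)
  refine ⟨v, σ, hσ, Lp.memLp v, ?_⟩
  have := (Lp.tendsto_Lp_iff_tendsto_eLpNorm' _ _).1 hlim
  refine this.congr fun n => eLpNorm_congr_ae ?_
  exact (((hζ (σ n)).memLp 1).coeFn_toLp).sub (EventuallyEq.refl _ _)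

/-! ### Uniform convexity of `L^p` and strong limits of convex combinations -/

section UniformConvexity

variable {V : Type*} [NormedAddCommGroup V] [InnerProductSpace ℝ V]

/-- If the norms agree, the strict inequality comes from strict convexity of the Hilbert norm; if
they differ, from strict convexity of t ↦ t^p. -/
theorem norm_half_add_rpow_lt {p : ℝ} (hp : 1 < p) {a b : V} (hab : a ≠ b) :
    ‖(1 / 2 : ℝ) • (a + b)‖ ^ p < (‖a‖ ^ p + ‖b‖ ^ p) / 2 := by
  have hp0 : 0 < p := by linarith
  by_cases h : ‖a‖ = ‖b‖
  · have h1 := (norm_midpoint_lt_iff h).2 hab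
    calc ‖(1 / 2 : ℝ) • (a + b)‖ ^ p < ‖a‖ ^ p := Real.rpow_lt_rpow (norm_nonneg _) h1 hp0
      _ = (‖a‖ ^ p + ‖b‖ ^ p) / 2 := by rw [← h]; ring
  · have h1 : ‖(1 / 2 : ℝ) • (a + b)‖ ≤ (1 / 2) * ‖a‖ + (1 / 2) * ‖b‖ := by
      rw [norm_smul, ← mul_add]
      have := norm_add_le a b
      norm_num
      linarith
    have h2 := (strictConvexOn_rpow hp).2 (norm_nonneg a) (norm_nonneg b) h
      (by norm_num : (0 : ℝ) < 1 / 2) (by norm_num : (0 : ℝ) < 1 / 2) (by norm_num)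
    simp only [smul_eq_mul] at h2
    calc ‖(1 / 2 : ℝ) • (a + b)‖ ^ p ≤ ((1 / 2) * ‖a‖ + (1 / 2) * ‖b‖) ^ p :=
          Real.rpow_le_rpow (norm_nonneg _) h1 hp0.le
      _ < (1 / 2) * ‖a‖ ^ p + (1 / 2) * ‖b‖ ^ p := h2
      _ = _ := by ring

theorem norm_half_add_rpow_le {p : ℝ} (hp : 1 < p) (a b : V) :
    ‖(1 / 2 : ℝ) • (a + b)‖ ^ p ≤ (‖a‖ ^ p + ‖b‖ ^ p) / 2 := by
  by_cases h : a = b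
  · subst h
    have e : (1 / 2 : ℝ) • (a + a) = a := by rw [← two_smul ℝ a, smul_smul]; norm_num
    rw [e]; linarith
  · exact (norm_half_add_rpow_lt hp h).le

/-- A quantitative form of the strict convexity of `‖·‖ ^ p`. -/
theorem exists_norm_sub_rpow_le [FiniteDimensional ℝ V] {p : ℝ} (hp : 1 < p) {ε : ℝ}
    (hε : 0 < ε) : ∃ C : ℝ, 0 ≤ C ∧ ∀ a b : V, ‖a - b‖ ^ p ≤ ε * (‖a‖ ^ p + ‖b‖ ^ p) +
      C * ((‖a‖ ^ p + ‖b‖ ^ p) / 2 - ‖(1 / 2 : ℝ) • (a + b)‖ ^ p) := by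
  have hp0 : 0 < p := by linarith
  have hcr : ∀ {f : V × V → V}, Continuous f → Continuous fun z => ‖f z‖ ^ p := fun hf =>
    hf.norm.rpow_const fun _ => Or.inr hp0.le
  -- By homogeneity it is enough to treat pairs with ‖a‖^p + ‖b‖^p = 1. If ‖a - b‖^p < ε, the first
  -- term suffices. The other pairs form a compact set, on which the convexity gap is bounded below
  -- by a positive constant.
  let S : Set (V × V) := {z | ‖z.1‖ ^ p + ‖z.2‖ ^ p = 1 ∧ ε ≤ ‖z.1 - z.2‖ ^ p}
  have hSc : IsCompact S := by
    refine Metric.isCompact_of_isClosed_isBounded ?_ ?_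
    · exact (isClosed_eq ((hcr continuous_fst).add (hcr continuous_snd)) continuous_const).inter
        (isClosed_le continuous_const (hcr (continuous_fst.sub continuous_snd)))
    · refine (Metric.isBounded_closedBall (x := (0 : V × V)) (r := 1)).subset fun z hz => ?_
      have hone : ∀ a : V, ‖a‖ ^ p ≤ 1 → ‖a‖ ≤ 1 := fun a ha => by
        by_contra! h
        exact absurd (Real.one_lt_rpow h hp0) (not_lt.2 ha)
      have p1 : 0 ≤ ‖z.1‖ ^ p := by positivity
      have p2 : 0 ≤ ‖z.2‖ ^ p := by positivity
      rw [mem_closedBall_zero_iff, Prod.norm_def]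
      exact max_le (hone _ (by linarith [hz.1])) (hone _ (by linarith [hz.1]))
  let gap : V × V → ℝ := fun z =>
    (‖z.1‖ ^ p + ‖z.2‖ ^ p) / 2 - ‖(1 / 2 : ℝ) • (z.1 + z.2)‖ ^ p
  have hgap : Continuous gap := (((hcr continuous_fst).add (hcr continuous_snd)).div_const 2).sub
    (hcr ((continuous_fst.add continuous_snd).const_smul _))
  obtain ⟨C, hC0, hC⟩ : ∃ C : ℝ, 0 ≤ C ∧ ∀ z ∈ S, ‖z.1 - z.2‖ ^ p ≤ C * gap z := by
    rcases S.eq_empty_or_nonempty with h | h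
    · exact ⟨0, le_rfl, by simp [h]⟩
    obtain ⟨z0, hz0, hmin⟩ := hSc.exists_isMinOn h hgap.continuousOn
    obtain ⟨M, hM⟩ := hSc.exists_bound_of_continuousOn
      (hcr (continuous_fst.sub continuous_snd)).continuousOn
    have hpos : 0 < gap z0 := by
      have hne : z0.1 ≠ z0.2 := fun he => by
        have := hz0.2
        rw [he, sub_self, norm_zero, Real.zero_rpow hp0.ne'] at this
        linarith
      exact sub_pos.2 (norm_half_add_rpow_lt hp hne)
    have hM0 : 0 ≤ M := (norm_nonneg _).trans (hM z0 hz0)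
    refine ⟨M / gap z0, by positivity, fun z hz => ?_⟩
    calc ‖z.1 - z.2‖ ^ p ≤ M := (le_abs_self _).trans (hM z hz)
      _ = M / gap z0 * gap z0 := by field_simp
      _ ≤ M / gap z0 * gap z := by gcongr; exact hmin hz
  refine ⟨C, hC0, fun a b => ?_⟩
  have hgap0 : ∀ z, 0 ≤ gap z := fun z => sub_nonneg.2 (norm_half_add_rpow_le hp z.1 z.2)
  set T := ‖a‖ ^ p + ‖b‖ ^ p with hT
  rcases (show 0 ≤ T by positivity).eq_or_lt with h0 | hpos
  · have p1 : 0 ≤ ‖a‖ ^ p := by positivity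
    have p2 : 0 ≤ ‖b‖ ^ p := by positivity
    have ha : a = 0 := by
      by_contra h
      have : 0 < ‖a‖ ^ p := Real.rpow_pos_of_pos (norm_pos_iff.2 h) p
      linarith
    have hb : b = 0 := by
      by_contra h
      have : 0 < ‖b‖ ^ p := Real.rpow_pos_of_pos (norm_pos_iff.2 h) p
      linarith
    rw [← h0, ha, hb]
    simp [Real.zero_rpow hp0.ne']
  · set t := T ^ (-(1 / p)) with ht
    have ht0 : 0 < t := Real.rpow_pos_of_pos hpos _
    have htp : t ^ p * T = 1 := by
      rw [ht, ← Real.rpow_mul hpos.le, neg_mul, one_div_mul_cancel hp0.ne', Real.rpow_neg_one,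
        inv_mul_cancel₀ hpos.ne']
    have hsc : ∀ c : V, ‖t • c‖ ^ p = t ^ p * ‖c‖ ^ p := fun c => by
      rw [norm_smul, Real.mul_rpow (norm_nonneg _) (norm_nonneg _), Real.norm_of_nonneg ht0.le]
    have hs1 : ‖t • a‖ ^ p + ‖t • b‖ ^ p = 1 := by rw [hsc, hsc, ← mul_add, htp]
    have hs2 : ‖t • a - t • b‖ ^ p = t ^ p * ‖a - b‖ ^ p := by rw [← smul_sub, hsc]
    have hs3 : gap (t • a, t • b) = t ^ p * gap (a, b) := by
      simp only [gap]
      rw [hs1, ← smul_add, smul_comm, hsc, mul_sub, ← mul_div_assoc, htp]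
    have key : t ^ p * ‖a - b‖ ^ p ≤ ε + C * (t ^ p * gap (a, b)) := by
      rw [← hs2, ← hs3]
      by_cases h : ε ≤ ‖t • a - t • b‖ ^ p
      · have := hC (t • a, t • b) ⟨hs1, h⟩
        simp only at this
        linarith
      · have := mul_nonneg hC0 (hgap0 (t • a, t • b))
        linarith [not_le.1 h]
    have htpos : 0 < t ^ p := Real.rpow_pos_of_pos ht0 p
    refine le_of_mul_le_mul_left ?_ htpos
    calc t ^ p * ‖a - b‖ ^ p ≤ ε * (t ^ p * T) + C * (t ^ p * gap (a, b)) := by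
          rw [htp, mul_one]; exact key
      _ = t ^ p * (ε * T + C * gap (a, b)) := by ring

variable {α : Type*} [MeasurableSpace α] {μ : Measure α}

/-- The constant depends on ε but not on f and g, so a small midpoint gap forces a small distance
along any sequence of bounded norm. -/
theorem integral_norm_sub_rpow_le [FiniteDimensional ℝ V] {p : ℝ} (hp : 1 < p) {ε : ℝ}
    (hε : 0 < ε) : ∃ C : ℝ, 0 ≤ C ∧ ∀ f g : α → V, MemLp f (ENNReal.ofReal p) μ →
      MemLp g (ENNReal.ofReal p) μ →
      ∫ x, ‖f x - g x‖ ^ p ∂μ ≤ ε * ((∫ x, ‖f x‖ ^ p ∂μ) + ∫ x, ‖g x‖ ^ p ∂μ) +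
        C * (((∫ x, ‖f x‖ ^ p ∂μ) + ∫ x, ‖g x‖ ^ p ∂μ) / 2 -
          ∫ x, ‖(1 / 2 : ℝ) • (f x + g x)‖ ^ p ∂μ) := by
  obtain ⟨C, hC0, hC⟩ := exists_norm_sub_rpow_le (V := V) hp hε
  have hp0 : 0 ≤ p := by linarith
  have hint : ∀ {f : α → V}, MemLp f (ENNReal.ofReal p) μ →
      Integrable (fun x => ‖f x‖ ^ p) μ := fun hf => by
    simpa [ENNReal.toReal_ofReal hp0] using hf.integrable_norm_rpow
      (by simpa using hp.trans' one_pos) ENNReal.ofReal_ne_top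
  refine ⟨C, hC0, fun f g hf hg => ?_⟩
  have i1 := hint hf
  have i2 := hint hg
  have i3 : Integrable (fun x => ‖(1 / 2 : ℝ) • (f x + g x)‖ ^ p) μ :=
    hint ((hf.add hg).const_smul (1 / 2 : ℝ))
  have i4 : Integrable (fun x => ‖f x - g x‖ ^ p) μ := hint (hf.sub hg)
  have i5 : Integrable (fun x => ‖f x‖ ^ p + ‖g x‖ ^ p) μ := i1.add i2
  have i6 : Integrable (fun x => (‖f x‖ ^ p + ‖g x‖ ^ p) / 2 -
      ‖(1 / 2 : ℝ) • (f x + g x)‖ ^ p) μ := (i5.div_const 2).sub i3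
  refine (integral_mono i4 ((i5.const_mul ε).add (i6.const_mul C))
    fun x => hC (f x) (g x)).trans_eq ?_
  simp only [Pi.add_apply]
  rw [integral_add (i5.const_mul ε) (i6.const_mul C), integral_const_mul, integral_const_mul,
    integral_sub (i5.div_const 2) i3, integral_div, integral_add i1 i2]

theorem eLpNorm_eq_ofReal_integral {F : Type*} [NormedAddCommGroup F] {p : ℝ} (hp : 0 < p)
    {f : α → F}
    (hf : MemLp f (ENNReal.ofReal p) μ) :
    eLpNorm f (ENNReal.ofReal p) μ = ENNReal.ofReal ((∫ x, ‖f x‖ ^ p ∂μ) ^ p⁻¹) := by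
  have := hf.eLpNorm_eq_integral_rpow_norm (by simpa using hp) ENNReal.ofReal_ne_top
  simpa [ENNReal.toReal_ofReal hp.le] using this

/-- A sequence whose norms and whose midpoint norms converge to the same limit converges. -/
theorem exists_tendsto_of_midpoint [FiniteDimensional ℝ V] {p : ℝ} (hp : 1 < p) {f : ℕ → α → V}
    (hf : ∀ n, MemLp (f n) (ENNReal.ofReal p) μ) {D : ℝ} {δ : ℕ → ℝ}
    (hδ : Tendsto δ atTop (𝓝 0))
    (h1 : ∀ k, ∀ n ≥ k, ∫ x, ‖f n x‖ ^ p ∂μ ≤ D + δ k)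
    (h2 : ∀ k, ∀ n ≥ k, ∀ m ≥ k, D - δ k ≤ ∫ x, ‖(1 / 2 : ℝ) • (f n x + f m x)‖ ^ p ∂μ) :
    ∃ g, MemLp g (ENNReal.ofReal p) μ ∧
      Tendsto (fun n => eLpNorm (f n - g) (ENNReal.ofReal p) μ) atTop (𝓝 0) := by
  have hp0 : 0 < p := by linarith
  have hP : 1 ≤ ENNReal.ofReal p := by simpa using ENNReal.ofReal_le_ofReal hp.le
  have : Fact (1 ≤ ENNReal.ofReal p) := ⟨hP⟩
  have hcau : ∀ η > 0, ∃ k, ∀ n ≥ k, ∀ m ≥ k, ∫ x, ‖f n x - f m x‖ ^ p ∂μ < η := by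
    intro η hη
    set B := |D| + 1 with hB
    have hB0 : 0 < B := by positivity
    -- The two integrals sum to at most 2B, so the first term is at most η/2. The gap is at most
    -- 2δ_k, and δ_k < η/(4(C + 1)) makes the second term less than η/2.
    obtain ⟨C, hC0, hC⟩ := integral_norm_sub_rpow_le (V := V) (μ := μ) hp
      (ε := η / (4 * B)) (by positivity)
    have ev1 : ∀ᶠ k in atTop, δ k < 1 := hδ.eventually (gt_mem_nhds one_pos)
    have ev2 : ∀ᶠ k in atTop, δ k < η / (4 * (C + 1)) :=
      hδ.eventually (gt_mem_nhds (by positivity))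
    obtain ⟨k, hk1, hk2⟩ := (ev1.and ev2).exists
    refine ⟨k, fun n hn m hm => (hC _ _ (hf n) (hf m)).trans_lt ?_⟩
    have a1 := h1 k n hn
    have a2 := h1 k m hm
    have a3 := h2 k n hn m hm
    have b1 : (∫ x, ‖f n x‖ ^ p ∂μ) + ∫ x, ‖f m x‖ ^ p ∂μ ≤ 2 * B := by
      have := le_abs_self D
      linarith
    have b2 : ((∫ x, ‖f n x‖ ^ p ∂μ) + ∫ x, ‖f m x‖ ^ p ∂μ) / 2 -
        (∫ x, ‖(1 / 2 : ℝ) • (f n x + f m x)‖ ^ p ∂μ) ≤ 2 * (η / (4 * (C + 1))) := by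
      linarith
    calc _ ≤ η / (4 * B) * (2 * B) + C * (2 * (η / (4 * (C + 1)))) := by gcongr
      _ = η / 2 + C / (C + 1) * (η / 2) := by field_simp; ring
      _ < η / 2 + 1 * (η / 2) := by
          gcongr
          rw [div_lt_one (by positivity)]; linarith
      _ = η := by ring
  let Z : ℕ → Lp V (ENNReal.ofReal p) μ := fun n => (hf n).toLp (f n)
  have hZ : CauchySeq Z := by
    rw [Metric.cauchySeq_iff]
    intro ε hε
    obtain ⟨k, hk⟩ := hcau (ε ^ p) (by positivity)
    refine ⟨k, fun n hn m hm => ?_⟩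
    have e : dist (Z n) (Z m) = (∫ x, ‖f n x - f m x‖ ^ p ∂μ) ^ p⁻¹ := by
      rw [Lp.dist_def, eLpNorm_congr_ae ((hf n).coeFn_toLp.sub (hf m).coeFn_toLp),
        eLpNorm_eq_ofReal_integral hp0 ((hf n).sub (hf m)), ENNReal.toReal_ofReal]
      · rfl
      · positivity
    rw [e]
    calc _ < (ε ^ p) ^ p⁻¹ :=
          Real.rpow_lt_rpow (integral_nonneg fun x => by positivity) (hk n hn m hm)
            (by positivity)
      _ = ε := Real.rpow_rpow_inv hε.le hp0.ne'
  obtain ⟨g, hg⟩ := cauchySeq_tendsto_of_complete hZ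
  refine ⟨g, Lp.memLp g, ((Lp.tendsto_Lp_iff_tendsto_eLpNorm' _ _).1 hg).congr fun n =>
    eLpNorm_congr_ae ?_⟩
  exact ((hf n).coeFn_toLp).sub (EventuallyEq.refl _ _)

end UniformConvexity

/-! ### Mazur-type argument: bounded `L^p` limits stay in `W^{1,p}_0` -/

theorem convex_setOf_isTest : Convex ℝ {ζ | IsTest Ω ζ} := fun _ hζ _ hη a b _ _ _ =>
  (IsTest.smul a hζ).add (IsTest.smul b hη)

theorem convex_setOf_eLpNorm_sub_le {p : ℝ} (hp : 1 ≤ p)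
    {v : EuclideanSpace ℝ (Fin N) → ℝ} (hv : AEStronglyMeasurable v (volume.restrict Ω))
    (ε : ℝ≥0∞) : Convex ℝ {ζ | IsTest Ω ζ ∧
      eLpNorm (ζ - v) (ENNReal.ofReal p) (volume.restrict Ω) ≤ ε} := by
  have hP : 1 ≤ ENNReal.ofReal p := by simpa using ENNReal.ofReal_le_ofReal hp
  intro ζ hζ η hη a b ha hb hab
  refine ⟨convex_setOf_isTest hζ.1 hη.1 ha hb hab, ?_⟩
  have e : a • ζ + b • η - v = a • (ζ - v) + b • (η - v) := by
    have : v = a • v + b • v := by rw [← add_smul, hab, one_smul]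
    nth_rw 1 [this]
    simp only [smul_sub]; abel
  rw [e]
  refine (eLpNorm_add_le (((hζ.1.memLp 1).1.sub hv).const_smul a)
    (((hη.1.memLp 1).1.sub hv).const_smul b) hP).trans ?_
  rw [eLpNorm_const_smul, eLpNorm_const_smul]
  calc _ ≤ ‖a‖ₑ * ε + ‖b‖ₑ * ε := by gcongr; exacts [hζ.2, hη.2]
    _ = ε := by
      rw [← add_mul, Real.enorm_of_nonneg ha, Real.enorm_of_nonneg hb,
        ← ENNReal.ofReal_add ha hb, hab, ENNReal.ofReal_one, one_mul]

/-- The limit in `L^p` of a sequence of test functions bounded in `W^{1,p}` is in `W^{1,p}_0`. -/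
theorem exists_hasGradW0_of_tendsto_of_bounded {p : ℝ} (hp : 1 < p)
    {ζ : ℕ → EuclideanSpace ℝ (Fin N) → ℝ} (hζ : ∀ n, IsTest Ω (ζ n)) {C : ℝ≥0}
    (hC : ∀ n, eLpNorm (gradient (ζ n)) (ENNReal.ofReal p) (volume.restrict Ω) ≤ C)
    {v : EuclideanSpace ℝ (Fin N) → ℝ} (hv : MemLp v (ENNReal.ofReal p) (volume.restrict Ω))
    (hlim : Tendsto (fun n => eLpNorm (ζ n - v) (ENNReal.ofReal p) (volume.restrict Ω)) atTop
      (𝓝 0)) : ∃ G, HasGradW0 p Ω v G := by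
  have hp0 : 0 < p := by linarith
  let I : (EuclideanSpace ℝ (Fin N) → ℝ) → ℝ := fun c => ∫ x in Ω, ‖gradient c x‖ ^ p
  have hI0 : ∀ c, 0 ≤ I c := fun c => integral_nonneg fun x => by positivity
  have hIC : ∀ n, I (ζ n) ≤ (C : ℝ) ^ p := fun n => by
    have h1 := hC n
    rw [eLpNorm_eq_ofReal_integral hp0 ((hζ n).memLp_gradient _),
      ENNReal.ofReal_le_iff_le_toReal ENNReal.coe_ne_top, ENNReal.coe_toReal] at h1
    calc I (ζ n) = (I (ζ n) ^ p⁻¹) ^ p := (Real.rpow_inv_rpow (hI0 _) hp0.ne').symm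
      _ ≤ (C : ℝ) ^ p := Real.rpow_le_rpow (Real.rpow_nonneg (hI0 _) _) h1 hp0.le
  -- These are the convex hulls of the tails of the sequence. The infimum d n of the gradient energy
  -- over K n increases with n to a finite limit D. For near-minimizers c n, the midpoint of c n and
  -- c m with n, m ≥ k still lies in K k, so its energy is at least d k. This is the input for
  -- `exists_tendsto_of_midpoint`.
  let K : ℕ → Set (EuclideanSpace ℝ (Fin N) → ℝ) := fun n => convexHull ℝ (ζ '' Ici n)
  have hKanti : ∀ {k n}, k ≤ n → K n ⊆ K k := fun h =>
    convexHull_mono (image_mono (Ici_subset_Ici.2 h))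
  have hKtest : ∀ n, K n ⊆ {c | IsTest Ω c} := fun n =>
    convexHull_min (by rintro _ ⟨m, -, rfl⟩; exact hζ m) convex_setOf_isTest
  have hζK : ∀ n, ζ n ∈ K n := fun n => subset_convexHull ℝ _ ⟨n, self_mem_Ici, rfl⟩
  let d : ℕ → ℝ := fun n => sInf (I '' K n)
  have hbdd : ∀ n, BddBelow (I '' K n) := fun n => ⟨0, by rintro _ ⟨c, -, rfl⟩; exact hI0 c⟩
  have hdle : ∀ n, ∀ c ∈ K n, d n ≤ I c := fun n c hc => csInf_le (hbdd n) ⟨c, hc, rfl⟩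
  have hdmono : Monotone d := fun k n h =>
    csInf_le_csInf (hbdd k) ⟨_, ζ n, hζK n, rfl⟩ (image_mono (hKanti h))
  have hdbdd : BddAbove (range d) :=
    ⟨(C : ℝ) ^ p, by rintro _ ⟨n, rfl⟩; exact (hdle n _ (hζK n)).trans (hIC n)⟩
  set D := ⨆ n, d n with hD
  have hdD : Tendsto d atTop (𝓝 D) := tendsto_atTop_ciSup hdmono hdbdd
  have hdD' : ∀ n, d n ≤ D := le_ciSup hdbdd
  have hex : ∀ n : ℕ, ∃ c ∈ K n, I c < d n + 1 / ((n : ℝ) + 1) := fun n => by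
    obtain ⟨_, ⟨c, hc, rfl⟩, h⟩ := exists_lt_of_csInf_lt (s := I '' K n) ⟨_, ζ n, hζK n, rfl⟩
      (show d n < d n + 1 / ((n : ℝ) + 1) by
        have : 0 < 1 / ((n : ℝ) + 1) := by positivity
        linarith)
    exact ⟨c, hc, h⟩
  choose c hcK hcI using hex
  have hct : ∀ n, IsTest Ω (c n) := fun n => hKtest n (hcK n)
  have hone : ∀ {k n : ℕ}, k ≤ n → 1 / ((n : ℝ) + 1) ≤ 1 / ((k : ℝ) + 1) := fun h =>
    one_div_le_one_div_of_le (by positivity) (by exact_mod_cast Nat.succ_le_succ h)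
  have hδ : Tendsto (fun k : ℕ => (D - d k) + 1 / ((k : ℝ) + 1)) atTop (𝓝 0) := by
    simpa using (hdD.const_sub D).add tendsto_one_div_add_atTop_nhds_zero_nat
  obtain ⟨G, hG, hcG⟩ := exists_tendsto_of_midpoint (D := D) hp
    (fun n => (hct n).memLp_gradient (Ω := Ω) (ENNReal.ofReal p)) hδ
    (fun k n hn => by
      change I (c n) ≤ _
      have := hone hn
      linarith [hcI n, hdD' n, hdD' k])
    (fun k n hn m hm => by
      have hmid : (1 / 2 : ℝ) • (c n + c m) ∈ K k := by
        rw [smul_add]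
        exact convex_convexHull ℝ _ (hKanti hn (hcK n)) (hKanti hm (hcK m)) (by norm_num)
          (by norm_num) (by norm_num)
      have h1 := hdle k _ hmid
      have e : gradient ((1 / 2 : ℝ) • (c n + c m)) =
          fun x => (1 / 2 : ℝ) • (gradient (c n) x + gradient (c m) x) := by
        rw [((hct n).add (hct m)).gradient_smul, (hct n).gradient_add (hct m)]; rfl
      simp only [I, e] at h1
      have : 0 < 1 / ((k : ℝ) + 1) := by positivity
      linarith)
  refine ⟨G, HasGradW0.of_tendsto hp.le (fun n => (hct n).hasGradW0 p) hv hG ?_ hcG⟩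
  -- L^p balls around v are convex: a ball containing a tail of ζ contains its convex hull, hence
  -- also the later c m.
  rw [ENNReal.tendsto_nhds_zero] at hlim ⊢
  intro ε hε
  obtain ⟨n, hn⟩ := eventually_atTop.1 (hlim ε hε)
  filter_upwards [eventually_ge_atTop n] with m hm
  exact (convexHull_min (by
    rintro _ ⟨j, hj, rfl⟩
    exact ⟨hζ j, hn j (hm.trans hj)⟩) (convex_setOf_eLpNorm_sub_le hp.le hv.1 ε) (hcK m)).2

/-! ### Compactness in `W^{1,p}_0` -/

/-- A subcritical exponent strictly above p leaves the room that Vitali's theorem needs to upgrade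
a.e. convergence to L^p convergence. -/
theorem exists_exponent_between (hN : 2 ≤ N) {p : ℝ} (hp : 1 < p) :
    ∃ s : ℝ, p < s ∧ (p < N → s < N * p / (N - p)) := by
  have hN' : (2 : ℝ) ≤ N := by exact_mod_cast hN
  by_cases h : p < N
  · have : p < N * p / (N - p) := by
      rw [lt_div_iff₀ (by linarith)]; nlinarith
    obtain ⟨s, h1, h2⟩ := exists_between this
    exact ⟨s, h1, fun _ => h2⟩
  · exact ⟨p + 1, by linarith, fun h' => absurd h' h⟩

theorem exists_eLpNorm_one_le [IsFiniteMeasure (volume.restrict Ω)] {p : ℝ} (hp : 1 ≤ p) :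
    ∃ c : ℝ≥0, ∀ {F : Type} [NormedAddCommGroup F] (f : EuclideanSpace ℝ (Fin N) → F),
      AEStronglyMeasurable f (volume.restrict Ω) → eLpNorm f 1 (volume.restrict Ω) ≤
        c * eLpNorm f (ENNReal.ofReal p) (volume.restrict Ω) := by
  have hP : 1 ≤ ENNReal.ofReal p := by simpa using ENNReal.ofReal_le_ofReal hp
  have hc : volume.restrict Ω univ ^
      (1 / (1 : ℝ≥0∞).toReal - 1 / (ENNReal.ofReal p).toReal) ≠ ⊤ := by
    refine ENNReal.rpow_ne_top_of_nonneg ?_ (measure_ne_top _ _)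
    rw [ENNReal.toReal_ofReal (by linarith)]
    have : 1 / p ≤ 1 := (div_le_one (by linarith)).2 hp
    simpa using this
  lift volume.restrict Ω univ ^
      (1 / (1 : ℝ≥0∞).toReal - 1 / (ENNReal.ofReal p).toReal) to ℝ≥0 using hc with c hcc
  refine ⟨c, fun f hf => ?_⟩
  rw [mul_comm, hcc]
  exact eLpNorm_le_eLpNorm_mul_rpow_measure_univ hP hf

/-- A bounded sequence in `W^{1,p}_0(Ω)` has a subsequence converging almost everywhere to an
element of `W^{1,p}_0(Ω)`. -/
theorem exists_subseq_ae_tendsto_of_bounded (hΩb : Bornology.IsBounded Ω) (hN : 2 ≤ N) {p : ℝ}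
    (hp : 1 < p) (hpN : p ≤ N) {v : ℕ → EuclideanSpace ℝ (Fin N) → ℝ}
    {G : ℕ → EuclideanSpace ℝ (Fin N) → EuclideanSpace ℝ (Fin N)}
    (hv : ∀ n, HasGradW0 p Ω (v n) (G n)) {C : ℝ≥0}
    (hC : ∀ n, eLpNorm (G n) (ENNReal.ofReal p) (volume.restrict Ω) ≤ C) :
    ∃ w H, HasGradW0 p Ω w H ∧ ∃ σ : ℕ → ℕ, StrictMono σ ∧
      ∀ᵐ x ∂(volume.restrict Ω), Tendsto (fun n => v (σ n) x) atTop (𝓝 (w x)) := by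
  have hp0 : 0 < p := by linarith
  have hP : 1 ≤ ENNReal.ofReal p := by simpa using ENNReal.ofReal_le_ofReal hp.le
  have := isFiniteMeasure_restrict_of_isBounded hΩb
  have hpos : ∀ n : ℕ, (0 : ℝ≥0∞) < ((n + 1 : ℕ) : ℝ≥0∞)⁻¹ := fun n => by
    simp [-Nat.cast_add]
  -- Rellich's theorem is available for test functions, so each v n is replaced by one within 1/(n +
  -- 1) in W^{1,p}. The shift keeps the error at most 1 for n = 0 too, so the gradients stay
  -- bounded.
  choose ζ hζ hζv hζG using fun n : ℕ => (hv n).2.2 _ (hpos n)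
  have hle1 : ∀ n : ℕ, ((n + 1 : ℕ) : ℝ≥0∞)⁻¹ ≤ 1 := fun n => by
    rw [ENNReal.inv_le_one]; exact_mod_cast Nat.succ_pos n
  have hgp : ∀ n, eLpNorm (gradient (ζ n)) (ENNReal.ofReal p) (volume.restrict Ω) ≤
      (C + 1 : ℝ≥0) := fun n => by
    have e : gradient (ζ n) = G n - (G n - gradient (ζ n)) := by abel
    rw [e]
    refine (eLpNorm_sub_le (hv n).2.1.1 ((hv n).2.1.1.sub ((hζ n).memLp_gradient 1).1) hP).trans ?_
    push_cast
    exact add_le_add (hC n) ((hζG n).le.trans (hle1 n))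
  obtain ⟨c, hc⟩ := exists_eLpNorm_one_le (Ω := Ω) hp.le
  obtain ⟨s, hps, hsp⟩ := exists_exponent_between hN hp
  obtain ⟨S, hS⟩ := IsTest.sobolev hΩb hN hp.le hpN (hp0.trans hps) hsp
  have hsob : ∀ n, eLpNorm (ζ n) (ENNReal.ofReal s) (volume.restrict Ω) ≤
      (S * (C + 1) : ℝ≥0) := fun n => by
    rw [ENNReal.coe_mul]
    exact (hS _ (hζ n)).trans (by gcongr; exact hgp n)
  obtain ⟨S', hS'⟩ := IsTest.sobolev hΩb hN hp.le hpN one_pos (fun h => by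
    rw [lt_div_iff₀ (by linarith)]
    have : (2 : ℝ) ≤ N := by exact_mod_cast hN
    nlinarith)
  rw [ENNReal.ofReal_one] at hS'
  obtain ⟨w, σ, hσ, hw1, hσw⟩ := exists_subseq_tendsto_of_isTest hΩb hζ
    (C := max (S' * (C + 1)) (c * (C + 1)))
    (fun n => by
      rw [ENNReal.coe_max]
      refine le_max_of_le_left ?_
      rw [ENNReal.coe_mul]
      exact (hS' _ (hζ n)).trans (by gcongr; exact hgp n))
    (fun n => by
      rw [ENNReal.coe_max]
      refine le_max_of_le_right ?_
      rw [ENNReal.coe_mul]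
      exact (hc _ ((hζ n).memLp_gradient 1).1).trans (by gcongr; exact hgp n))
  rw [← ENNReal.ofReal_one] at hσw
  obtain ⟨τ, hτ, hae⟩ := exists_subseq_ae_tendsto one_pos
    (fun n => ((hζ (σ n)).memLp 1).1) hw1.1 hσw
  have hστ : StrictMono (σ ∘ τ) := hσ.comp hτ
  have hws : eLpNorm w (ENNReal.ofReal s) (volume.restrict Ω) ≤ (S * (C + 1) : ℝ≥0) :=
    Lp.eLpNorm_le_of_ae_tendsto (Eventually.of_forall fun n => hsob (σ (τ n)))
      (fun n => ((hζ (σ (τ n))).memLp 1).1) hae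
  have hP' : 1 ≤ ENNReal.ofReal s := hP.trans (ENNReal.ofReal_le_ofReal hps.le)
  have hwp : MemLp w (ENNReal.ofReal p) (volume.restrict Ω) :=
    MemLp.mono_exponent ⟨hw1.1, hws.trans_lt ENNReal.coe_lt_top⟩ (ENNReal.ofReal_le_ofReal hps.le)
  have hconv : Tendsto (fun n => eLpNorm (ζ (σ (τ n)) - w) (ENNReal.ofReal p)
      (volume.restrict Ω)) atTop (𝓝 0) := by
    refine tendsto_eLpNorm_zero_of_bounded hp0 hps
      (C := S * (C + 1) + S * (C + 1)) (fun n => ((hζ (σ (τ n))).memLp 1).1.sub hw1.1)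
      (fun n => (eLpNorm_sub_le ((hζ (σ (τ n))).memLp 1).1 hw1.1 hP').trans ?_) ?_
    · rw [ENNReal.coe_add]
      exact add_le_add (hsob _) hws
    · filter_upwards [hae] with x hx
      simpa using hx.sub_const (w x)
  obtain ⟨H, hH⟩ := exists_hasGradW0_of_tendsto_of_bounded hp (fun n => hζ (σ (τ n)))
    (fun n => hgp (σ (τ n))) hwp hconv
  have hdiff : Tendsto (fun n => eLpNorm ((v (σ (τ n)) - ζ (σ (τ n))) - 0) (ENNReal.ofReal p)
      (volume.restrict Ω)) atTop (𝓝 0) := by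
    have h1 : Tendsto (fun n : ℕ => ((n + 1 : ℕ) : ℝ≥0∞)⁻¹) atTop (𝓝 0) :=
      ENNReal.tendsto_inv_nat_nhds_zero.comp (tendsto_add_atTop_nat 1)
    refine tendsto_of_tendsto_of_tendsto_of_le_of_le tendsto_const_nhds
      (h1.comp hστ.tendsto_atTop) (fun _ => zero_le) fun n => ?_
    rw [sub_zero]
    exact (hζv _).le
  -- A further subsequence makes v - ζ tend to 0 a.e., which transfers the a.e. limit from the test
  -- functions back to v.
  obtain ⟨κ, hκ, hae'⟩ := exists_subseq_ae_tendsto hp0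
    (fun n => (hv (σ (τ n))).1.1.sub ((hζ (σ (τ n))).memLp 1).1) aestronglyMeasurable_zero hdiff
  refine ⟨w, H, hH, σ ∘ τ ∘ κ, hστ.comp hκ, ?_⟩
  filter_upwards [hae, hae'] with x h1 h2
  simpa using h2.add (h1.comp hκ.tendsto_atTop)

/-! ### The diffeomorphism `φ_p` -/

/-- The derivative of `φ_p`. -/
noncomputable def phiDeriv (p t : ℝ) : ℝ :=
  1 / ((1 + t ^ 2) * Real.log (Real.exp 1 + t ^ 2) ^ 4) ^ (1 / (2 * p))

theorem one_le_log_exp_one_add_sq (t : ℝ) : 1 ≤ Real.log (Real.exp 1 + t ^ 2) := by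
  rw [Real.le_log_iff_exp_le (by positivity)]
  nlinarith [sq_nonneg t]

theorem one_le_phi_weight (t : ℝ) : 1 ≤ (1 + t ^ 2) * Real.log (Real.exp 1 + t ^ 2) ^ 4 :=
  one_le_mul_of_one_le_of_one_le (by nlinarith [sq_nonneg t])
    (one_le_pow₀ (one_le_log_exp_one_add_sq t))

theorem phiDeriv_pos (p t : ℝ) : 0 < phiDeriv p t :=
  one_div_pos.2 (Real.rpow_pos_of_pos (one_pos.trans_le (one_le_phi_weight t)) _)

theorem phiDeriv_neg (p t : ℝ) : phiDeriv p (-t) = phiDeriv p t := by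
  simp [phiDeriv]

theorem contDiff_phiDeriv (p : ℝ) : ContDiff ℝ ∞ (phiDeriv p) := by
  have hpos : ∀ t : ℝ, 0 < Real.exp 1 + t ^ 2 := fun t => by positivity
  have h1 : ContDiff ℝ ∞ fun t : ℝ => Real.log (Real.exp 1 + t ^ 2) :=
    (contDiff_const.add (contDiff_id.pow 2)).log fun t => (hpos t).ne'
  have h2 : ContDiff ℝ ∞ fun t : ℝ => (1 + t ^ 2) * Real.log (Real.exp 1 + t ^ 2) ^ 4 :=
    (contDiff_const.add (contDiff_id.pow 2)).mul (h1.pow 4)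
  have hw : ∀ t : ℝ, 0 < (1 + t ^ 2) * Real.log (Real.exp 1 + t ^ 2) ^ 4 := fun t =>
    one_pos.trans_le (one_le_phi_weight t)
  exact contDiff_const.div (h2.rpow_const_of_ne fun t => (hw t).ne')
    fun t => (Real.rpow_pos_of_pos (hw t) _).ne'

theorem continuous_phiDeriv (p : ℝ) : Continuous (phiDeriv p) := (contDiff_phiDeriv p).continuous

theorem phi_zero (p : ℝ) : phi p 0 = 0 := by simp [phi]

theorem hasDerivAt_phi (p s : ℝ) : HasDerivAt (phi p) (phiDeriv p s) s :=
  integral_zero_to_hasDerivAt (continuous_phiDeriv p) s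

theorem contDiff_phi (p : ℝ) : ContDiff ℝ ∞ (phi p) :=
  contDiff_integral_zero_to (contDiff_phiDeriv p)

theorem strictMono_phi (p : ℝ) : StrictMono (phi p) :=
  strictMono_of_hasDerivAt_pos (hasDerivAt_phi p) fun s => phiDeriv_pos p s

theorem phi_neg (p s : ℝ) : phi p (-s) = -phi p s := by
  have h := intervalIntegral.integral_comp_neg (a := 0) (b := s) (phiDeriv p)
  simp only [phiDeriv_neg, neg_zero] at h
  change (∫ t in (0 : ℝ)..-s, phiDeriv p t) = -∫ t in (0 : ℝ)..s, phiDeriv p t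
  rw [h, intervalIntegral.integral_symm]

theorem abs_phi (p s : ℝ) : |phi p s| = phi p |s| := by
  rcases le_total 0 s with h | h
  · rw [abs_of_nonneg h, abs_of_nonneg]
    exact (phi_zero p).symm.le.trans ((strictMono_phi p).monotone h)
  · rw [abs_of_nonpos h, phi_neg, abs_of_nonpos]
    exact ((strictMono_phi p).monotone h).trans (phi_zero p).le

theorem phi_pos {p s : ℝ} (hs : 0 < s) : 0 < phi p s := by
  have := strictMono_phi p hs
  rwa [phi_zero] at this

theorem abs_phi_lt_iff {p s k : ℝ} : |phi p s| < phi p k ↔ |s| < k := by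
  rw [abs_phi, (strictMono_phi p).lt_iff_lt]

/-- `1 / φ_p'` grows more slowly than any power above `1 / p`. -/
theorem exists_inv_phiDeriv_le {p α : ℝ} (hp : 1 < p) (hα : α < 1 - 1 / p) :
    ∃ C : ℝ, 0 < C ∧ ∀ s, 1 / phiDeriv p s ≤ C * (1 + |s|) ^ (1 - α) := by
  have hp0 : 0 < p := by linarith
  -- Chosen so that (2 + 4η)/(2p) = 1 - α: each of the four logarithmic factors may cost a power η.
  set η := p * (1 - 1 / p - α) / 2 with hη
  have hη0 : 0 < η := by
    have : 0 < 1 - 1 / p - α := by linarith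
    positivity
  set K := 1 + 2 / η with hK
  have hK0 : 0 < K := by positivity
  refine ⟨(K ^ 4) ^ (1 / (2 * p)), by positivity, fun s => ?_⟩
  have hx1 : 1 ≤ 1 + |s| := by linarith [abs_nonneg s]
  have hx0 : 0 < 1 + |s| := by linarith
  have hsq : 1 + s ^ 2 ≤ (1 + |s|) ^ 2 := by nlinarith [sq_abs s, abs_nonneg s]
  have hlog : Real.log (Real.exp 1 + s ^ 2) ≤ K * (1 + |s|) ^ η := by
    have h1 : Real.exp 1 + s ^ 2 ≤ Real.exp 1 * (1 + |s|) ^ 2 := by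
      have he : 1 ≤ Real.exp 1 := Real.one_le_exp (by norm_num)
      nlinarith [sq_nonneg s]
    have h2 : Real.log (Real.exp 1 * (1 + |s|) ^ 2) = 1 + 2 * Real.log (1 + |s|) := by
      rw [Real.log_mul (by positivity) (by positivity), Real.log_exp, Real.log_pow]
      norm_num
    have h3 := Real.log_le_rpow_div hx0.le hη0
    have h4 : 1 ≤ (1 + |s|) ^ η := Real.one_le_rpow hx1 hη0.le
    calc Real.log (Real.exp 1 + s ^ 2) ≤ 1 + 2 * Real.log (1 + |s|) := by
          rw [← h2]; exact Real.log_le_log (by positivity) h1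
      _ ≤ (1 + |s|) ^ η + 2 * ((1 + |s|) ^ η / η) := by gcongr
      _ = K * (1 + |s|) ^ η := by rw [hK]; ring
  have hw : (1 + s ^ 2) * Real.log (Real.exp 1 + s ^ 2) ^ 4 ≤
      K ^ 4 * (1 + |s|) ^ (2 + 4 * η) := by
    have h0 : 0 ≤ Real.log (Real.exp 1 + s ^ 2) :=
      zero_le_one.trans (one_le_log_exp_one_add_sq s)
    calc _ ≤ (1 + |s|) ^ 2 * (K * (1 + |s|) ^ η) ^ 4 := by gcongr
      _ = K ^ 4 * ((1 + |s|) ^ (2 : ℝ) * ((1 + |s|) ^ η) ^ (4 : ℝ)) := by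
          rw [Real.rpow_two, show (4 : ℝ) = ((4 : ℕ) : ℝ) by norm_num, Real.rpow_natCast]; ring
      _ = K ^ 4 * (1 + |s|) ^ (2 + 4 * η) := by
          rw [← Real.rpow_mul hx0.le, ← Real.rpow_add hx0, mul_comm η]
  have hw0 : 0 ≤ (1 + s ^ 2) * Real.log (Real.exp 1 + s ^ 2) ^ 4 :=
    zero_le_one.trans (one_le_phi_weight s)
  rw [phiDeriv, one_div_one_div]
  calc _ ≤ (K ^ 4 * (1 + |s|) ^ (2 + 4 * η)) ^ (1 / (2 * p)) :=
        Real.rpow_le_rpow hw0 hw (by positivity)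
    _ = (K ^ 4) ^ (1 / (2 * p)) * (1 + |s|) ^ (1 - α) := by
        rw [Real.mul_rpow (by positivity) (by positivity), ← Real.rpow_mul hx0.le]
        congr 2
        rw [hη]
        field_simp
        ring

/-- `φ_p` grows faster than any power below `1 - 1 / p`. -/
theorem exists_one_add_abs_rpow_le {p α : ℝ} (hp : 1 < p) (hα0 : 0 < α) (hα : α < 1 - 1 / p) :
    ∃ C : ℝ, 0 < C ∧ ∀ s, (1 + |s|) ^ α ≤ C * (1 + |phi p s|) := by
  obtain ⟨c, hc0, hc⟩ := exists_inv_phiDeriv_le hp hα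
  -- Integrated form of (1 + s)^{α-1} ≤ c φ_p'(s), which is the bound on 1/φ_p' rewritten.
  have key : ∀ s, 0 ≤ s → (1 + s) ^ α - 1 ≤ α * c * phi p s := by
    intro s hs
    have hmono : MonotoneOn (fun s => α * c * phi p s - (1 + s) ^ α) (Ici 0) := by
      have hd : ∀ s : ℝ, 0 ≤ s → HasDerivAt (fun s => α * c * phi p s - (1 + s) ^ α)
          (α * c * phiDeriv p s - α * (1 + s) ^ (α - 1)) s := fun s hs => by
        have h1 : HasDerivAt (fun s : ℝ => (1 + s) ^ α) (1 * α * (1 + s) ^ (α - 1)) s :=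
          ((hasDerivAt_id s).const_add 1).rpow_const (Or.inl (by simp; linarith))
        rw [one_mul] at h1
        exact ((hasDerivAt_phi p s).const_mul (α * c)).sub h1
      refine monotoneOn_of_hasDerivWithinAt_nonneg (convex_Ici 0)
        (fun s hs => (hd s hs).continuousAt.continuousWithinAt)
        (fun s hs => (hd s (interior_subset hs)).hasDerivWithinAt) fun s hs => ?_
      have hs0 : 0 ≤ s := interior_subset hs
      have h1 := hc s
      rw [abs_of_nonneg hs0, div_le_iff₀ (phiDeriv_pos p s)] at h1
      have hx : 0 < (1 + s) ^ (1 - α) := Real.rpow_pos_of_pos (by linarith) _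
      have e : (1 + s) ^ (α - 1) = ((1 + s) ^ (1 - α))⁻¹ := by
        rw [← Real.rpow_neg (by linarith), neg_sub]
      have h2 : (1 + s) ^ (α - 1) ≤ c * phiDeriv p s := by
        rw [e, inv_le_iff_one_le_mul₀ hx]
        linarith
      have := mul_le_mul_of_nonneg_left h2 hα0.le
      linarith
    have := hmono (mem_Ici.2 le_rfl) (mem_Ici.2 hs) hs
    simp only [phi_zero, mul_zero, add_zero, Real.one_rpow] at this
    linarith
  refine ⟨1 + α * c, by positivity, fun s => ?_⟩
  have h1 := key |s| (abs_nonneg s)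
  rw [← abs_phi] at h1
  have := abs_nonneg (phi p s)
  have : 0 ≤ α * c := by positivity
  nlinarith

theorem tendsto_phi_atTop {p : ℝ} (hp : 1 < p) : Tendsto (phi p) atTop atTop := by
  have hα : 0 < 1 - 1 / p := by
    have : 1 / p < 1 := (div_lt_one (by linarith)).2 hp
    linarith
  obtain ⟨C, hC0, hC⟩ := exists_one_add_abs_rpow_le hp (half_pos hα) (half_lt_self hα)
  have h1 : Tendsto (fun s : ℝ => (1 + s) ^ ((1 - 1 / p) / 2) / C + (-1)) atTop atTop :=
    tendsto_atTop_add_const_right _ _ (((tendsto_rpow_atTop (half_pos hα)).comp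
      (tendsto_atTop_add_const_left _ 1 tendsto_id)).atTop_div_const hC0)
  refine tendsto_atTop_mono' _ ?_ h1
  filter_upwards [eventually_ge_atTop 0] with s hs
  have h2 := hC s
  rw [abs_phi, abs_of_nonneg hs] at h2
  have : (1 + s) ^ ((1 - 1 / p) / 2) / C ≤ 1 + phi p s := by
    rw [div_le_iff₀ hC0]; linarith
  linarith

theorem surjective_phi {p : ℝ} (hp : 1 < p) : Function.Surjective (phi p) := by
  refine (contDiff_phi p).continuous.surjective (tendsto_phi_atTop hp) ?_
  have : phi p = fun s => -phi p (-s) := by ext s; rw [phi_neg, neg_neg]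
  rw [this]
  exact tendsto_neg_atTop_atBot.comp ((tendsto_phi_atTop hp).comp tendsto_neg_atBot_atTop)

/-- The inverse of `φ_p` is smooth. -/
theorem exists_phi_inverse {p : ℝ} (hp : 1 < p) : ∃ ψ : ℝ → ℝ, ContDiff ℝ ∞ ψ ∧
    (∀ s, ψ (phi p s) = s) ∧ (∀ s, phi p (ψ s) = s) ∧
    ∀ s, HasDerivAt ψ (1 / phiDeriv p (ψ s)) s := by
  let e : ℝ ≃ₜ ℝ := ((strictMono_phi p).orderIsoOfSurjective _ (surjective_phi hp)).toHomeomorph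
  have he : ∀ s, e s = phi p s := fun _ => rfl
  have hd : ∀ s, HasDerivAt e (phiDeriv p s) s := hasDerivAt_phi p
  refine ⟨e.symm, e.contDiff_symm_deriv (fun s => (phiDeriv_pos p s).ne') hd (contDiff_phi p),
    fun s => e.symm_apply_apply s, fun s => e.apply_symm_apply s, fun s => ?_⟩
  rw [one_div]
  exact (hd (e.symm s)).of_local_left_inverse e.symm.continuous.continuousAt
    (phiDeriv_pos p _).ne' (Eventually.of_forall fun y => e.apply_symm_apply y)

/-! ### Truncations -/

theorem trunc_of_le {k s : ℝ} (h : |s| ≤ k) : trunc k s = s := if_pos h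

theorem trunc_of_lt {k s : ℝ} (h : k < s) (hk : 0 < k) : trunc k s = k := by
  have hs : 0 < s := hk.trans h
  rw [trunc, abs_of_pos hs, if_neg (not_le.2 h), div_self hs.ne', mul_one]

theorem trunc_of_lt_neg {k s : ℝ} (h : s < -k) (hk : 0 < k) : trunc k s = -k := by
  have hs : s < 0 := by linarith
  rw [trunc, abs_of_neg hs, if_neg (by linarith), div_neg, div_self hs.ne]
  ring

theorem intervalIntegral_indicator_abs_lt_of_le {a y : ℝ} {h : ℝ → ℝ} (hy : |y| ≤ a) :
    ∫ t in (0 : ℝ)..y, indicator {t | |t| < a} h t = ∫ t in (0 : ℝ)..y, h t := by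
  refine intervalIntegral.integral_congr_ae ?_
  filter_upwards [Measure.ae_ne volume a, Measure.ae_ne volume (-a)] with t h1 h2 ht
  refine indicator_of_mem (s := {t | |t| < a}) (show |t| < a from ?_) h
  obtain ⟨h3, h4⟩ := abs_le.1 hy
  have ht' := uIoc_subset_uIcc ht
  rcases le_total 0 y with h0 | h0
  · rw [uIcc_of_le h0] at ht'
    exact abs_lt.2 ⟨lt_of_le_of_ne (by linarith [ht'.1]) h2.symm,
      lt_of_le_of_ne (by linarith [ht'.2]) h1⟩
  · rw [uIcc_of_ge h0] at ht'
    exact abs_lt.2 ⟨lt_of_le_of_ne (by linarith [ht'.1]) h2.symm,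
      lt_of_le_of_ne (by linarith [ht'.2]) h1⟩

theorem intervalIntegral_indicator_abs_lt_eq_zero {a b y : ℝ} {h : ℝ → ℝ}
    (hb : ∀ t ∈ uIoc b y, a ≤ |t|) :
    ∫ t in b..y, indicator {t | |t| < a} h t = 0 := by
  refine intervalIntegral.integral_zero_ae (ae_of_all _ fun t ht => ?_)
  exact indicator_of_notMem (s := {t | |t| < a}) (not_lt.2 (hb t ht)) h

/-- Truncation of `u` as a function of `φ_p(u)`. -/
theorem trunc_eq_integral {p k s : ℝ} (hk : 0 < k) {ψ : ℝ → ℝ}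
    (hψ : ContDiff ℝ ∞ ψ) (hψφ : ∀ s, ψ (phi p s) = s)
    (hd : ∀ s, HasDerivAt ψ (1 / phiDeriv p (ψ s)) s) :
    trunc k s = ∫ t in (0 : ℝ)..phi p s,
      indicator {t | |t| < phi p k} (fun t => 1 / phiDeriv p (ψ t)) t := by
  have hc : Continuous fun t => 1 / phiDeriv p (ψ t) :=
    continuous_const.div ((continuous_phiDeriv p).comp hψ.continuous)
      fun t => (phiDeriv_pos p _).ne'
  have hint : ∀ s, ∫ t in (0 : ℝ)..phi p s, 1 / phiDeriv p (ψ t) = s := fun s => by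
    have := intervalIntegral.integral_eq_sub_of_hasDerivAt (a := 0) (b := phi p s)
      (fun t _ => hd t) (hc.intervalIntegrable _ _)
    have h0 := hψφ 0
    rw [phi_zero] at h0
    rw [this, hψφ, h0, sub_zero]
  have hm : MeasurableSet {t : ℝ | |t| < phi p k} :=
    (isOpen_lt continuous_abs continuous_const).measurableSet
  have hi : ∀ a b, IntervalIntegrable
      (indicator {t | |t| < phi p k} fun t => 1 / phiDeriv p (ψ t)) volume a b := fun a b =>
    ⟨(hc.intervalIntegrable a b).1.indicator hm, (hc.intervalIntegrable a b).2.indicator hm⟩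
  have hpk := phi_pos (p := p) hk
  rcases le_or_gt |s| k with h | h
  · rw [trunc_of_le h, intervalIntegral_indicator_abs_lt_of_le, hint]
    rw [abs_phi]
    exact (strictMono_phi p).monotone h
  -- Past the level k the integrand is zero, so the integral keeps the value ±k it has at φ_p(±k).
  · rcases lt_or_ge s 0 with h0 | h0
    · rw [abs_of_neg h0] at h
      have hlt : phi p s < phi p (-k) := strictMono_phi p (by linarith)
      rw [trunc_of_lt_neg (by linarith) hk,
        ← intervalIntegral.integral_add_adjacent_intervals (hi 0 (phi p (-k))) (hi _ _),
        intervalIntegral_indicator_abs_lt_of_le (by rw [abs_phi, abs_neg, abs_of_pos hk]),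
        hint, intervalIntegral_indicator_abs_lt_eq_zero, add_zero]
      intro t ht
      rw [uIoc_of_ge hlt.le] at ht
      have h1 := ht.2
      rw [phi_neg] at h1
      exact le_abs.2 (Or.inr (by linarith))
    · rw [abs_of_nonneg h0] at h
      have hlt : phi p k < phi p s := strictMono_phi p h
      rw [trunc_of_lt h hk,
        ← intervalIntegral.integral_add_adjacent_intervals (hi 0 (phi p k)) (hi _ _),
        intervalIntegral_indicator_abs_lt_of_le (by rw [abs_phi, abs_of_pos hk]),
        hint, intervalIntegral_indicator_abs_lt_eq_zero, add_zero]
      intro t ht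
      rw [uIoc_of_le hlt.le] at ht
      exact le_abs.2 (Or.inl ht.1.le)

/-! ### Growth estimates -/

/-- Up to logarithms |φ_p(s)| grows like |s|^{(p-1)/p}, so |s|^{p-1} is of order |φ_p(s)|^p; taking
β > p absorbs the logarithms. -/
theorem exists_abs_rpow_le_of_phi {p β : ℝ} (hp : 1 < p) (hβ : p < β) :
    ∃ C : ℝ, 0 < C ∧ ∀ s, |s| ^ (p - 1) ≤ C * (1 + |phi p s|) ^ β := by
  have hp0 : 0 < p - 1 := by linarith
  have hβ0 : 0 < β := by linarith
  have hα : (p - 1) / β < 1 - 1 / p := by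
    have : 1 - 1 / p = (p - 1) / p := by field_simp
    rw [this]
    exact div_lt_div_of_pos_left hp0 (by linarith) hβ
  obtain ⟨C, hC0, hC⟩ := exists_one_add_abs_rpow_le hp (by positivity) hα
  refine ⟨C ^ β, by positivity, fun s => ?_⟩
  have hs := abs_nonneg s
  calc |s| ^ (p - 1) ≤ (1 + |s|) ^ (p - 1) := by gcongr; linarith
    _ = ((1 + |s|) ^ ((p - 1) / β)) ^ β := by
        rw [← Real.rpow_mul (by positivity), div_mul_cancel₀ _ hβ0.ne']
    _ ≤ (C * (1 + |phi p s|)) ^ β := by gcongr; exact hC s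
    _ = C ^ β * (1 + |phi p s|) ^ β := Real.mul_rpow hC0.le (by positivity)

/-- Up to logarithms (1/φ_p')^{p-1} grows like |s|^{(p-1)/p}, the same order as |φ_p|; hence any
power β > 1 dominates. -/
theorem exists_inv_phiDeriv_rpow_le_of_phi {p β : ℝ} (hp : 1 < p) (hβ : 1 < β) :
    ∃ C : ℝ, 0 < C ∧ ∀ s, (1 / phiDeriv p s) ^ (p - 1) ≤ C * (1 + |phi p s|) ^ β := by
  have hp0 : 0 < p - 1 := by linarith
  have hβ0 : 0 < β := by linarith
  -- The solution of (1 - α)(p - 1) = αβ, which matches the two growth bounds; β > 1 makes it less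
  -- than 1 - 1/p.
  set α := (p - 1) / (β + (p - 1)) with hαdef
  have hα0 : 0 < α := by positivity
  have hα : α < 1 - 1 / p := by
    have : 1 - 1 / p = (p - 1) / p := by field_simp
    rw [this]
    exact div_lt_div_of_pos_left hp0 (by linarith) (by linarith)
  obtain ⟨c, hc0, hc⟩ := exists_inv_phiDeriv_le hp hα
  obtain ⟨C, hC0, hC⟩ := exists_one_add_abs_rpow_le hp hα0 hα
  refine ⟨c ^ (p - 1) * C ^ β, by positivity, fun s => ?_⟩
  have hs := abs_nonneg s
  have hg := phiDeriv_pos p s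
  calc (1 / phiDeriv p s) ^ (p - 1) ≤ (c * (1 + |s|) ^ (1 - α)) ^ (p - 1) := by
        gcongr; exact hc s
    _ = c ^ (p - 1) * ((1 + |s|) ^ α) ^ β := by
        rw [Real.mul_rpow hc0.le (by positivity), ← Real.rpow_mul (by positivity),
          ← Real.rpow_mul (by positivity)]
        congr 2
        rw [hαdef]
        field_simp
        ring
    _ ≤ c ^ (p - 1) * (C * (1 + |phi p s|)) ^ β := by gcongr; exact hC s
    _ = c ^ (p - 1) * C ^ β * (1 + |phi p s|) ^ β := by
        rw [Real.mul_rpow hC0.le (by positivity), mul_assoc]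

/-- The L^r norm of a β-th power is the β-th power of an L^{rβ} norm, to which Sobolev applies. The
quasi-norm constant `LpAddConst` is there because rβ may be less than 1. -/
theorem HasGradW0.exists_eLpNorm_one_add_rpow_le (hΩb : Bornology.IsBounded Ω) (hN : 2 ≤ N)
    {p : ℝ} (hp : 1 ≤ p) (hpN : p ≤ N) {r β : ℝ} (hr : 0 < r) (hβ : 0 < β)
    (hrp : p < N → r * β < N * p / (N - p)) (M : ℝ≥0) :
    ∃ K : ℝ≥0, ∀ v G, HasGradW0 p Ω v G →
      eLpNorm G (ENNReal.ofReal p) (volume.restrict Ω) ≤ M →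
      eLpNorm (fun x => (1 + |v x|) ^ β) (ENNReal.ofReal r) (volume.restrict Ω) ≤ K := by
  have := isFiniteMeasure_restrict_of_isBounded hΩb
  have hs : 0 < r * β := mul_pos hr hβ
  obtain ⟨S, hS⟩ := HasGradW0.sobolev hΩb hN hp hpN hs hrp
  set P := ENNReal.ofReal (r * β) with hP
  have hB : (ENNReal.LpAddConst P * (eLpNorm (fun _ : EuclideanSpace ℝ (Fin N) => (1 : ℝ)) P
      (volume.restrict Ω) + S * M)) ^ β ≠ ⊤ := by
    refine ENNReal.rpow_ne_top_of_nonneg hβ.le (ENNReal.mul_ne_top (ENNReal.LpAddConst_lt_top P).ne ?_)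
    exact ENNReal.add_ne_top.2 ⟨(memLp_const 1).2.ne,
      ENNReal.mul_ne_top ENNReal.coe_ne_top ENNReal.coe_ne_top⟩
  lift (ENNReal.LpAddConst P * (eLpNorm (fun _ : EuclideanSpace ℝ (Fin N) => (1 : ℝ)) P
      (volume.restrict Ω) + S * M)) ^ β to ℝ≥0 using hB with K hK
  refine ⟨K, fun v G h hG => ?_⟩
  have e : (fun x => (1 + |v x|) ^ β) = fun x => ‖1 + |v x|‖ ^ β := by
    ext1 x
    rw [Real.norm_of_nonneg (by positivity)]
  rw [e, eLpNorm_norm_rpow _ hβ, ← ENNReal.ofReal_mul hr.le]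
  rw [hK]
  gcongr
  refine (eLpNorm_add_le' aestronglyMeasurable_const h.1.1.norm P).trans ?_
  gcongr
  rw [eLpNorm_norm]
  exact (hS v G h).trans (by gcongr)

/-- Strictness of the subcritical condition leaves room for an exponent above b; it is this margin
that absorbs the logarithms of φ_p. -/
theorem exists_exponent_gap {p t b : ℝ} (ht : 0 < t)
    (h : p < N → t * b < N * p / (N - p)) :
    ∃ β, b < β ∧ (p < N → t * β < N * p / (N - p)) := by
  by_cases hpN : p < N
  · have h1 : b < N * p / (N - p) / t := by
      rw [lt_div_iff₀ ht]; linarith [h hpN]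
    obtain ⟨β, h2, h3⟩ := exists_between h1
    refine ⟨β, h2, fun _ => ?_⟩
    rw [lt_div_iff₀ ht] at h3
    linarith
  · exact ⟨b + 1, by linarith, fun h' => absurd h' hpN⟩

/-- Bounds for `|u| ^ (p - 1)` in terms of `∇[φ_p(u)]`. -/
theorem exists_eLpNorm_abs_rpow_le (hΩb : Bornology.IsBounded Ω) (hN : 2 ≤ N) {p : ℝ}
    (hp : 1 < p) (hpN : p ≤ N) {r : ℝ} (hr : 0 < r) (hrp : p < N → r < N / (N - p)) (M : ℝ≥0) :
    ∃ K : ℝ≥0, ∀ (u : EuclideanSpace ℝ (Fin N) → ℝ) G,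
      HasGradW0 p Ω (fun x => phi p (u x)) G →
      eLpNorm G (ENNReal.ofReal p) (volume.restrict Ω) ≤ M →
      eLpNorm (fun x => |u x| ^ (p - 1)) (ENNReal.ofReal r) (volume.restrict Ω) ≤ K := by
  have hp0 : 0 < p := by linarith
  obtain ⟨β, hβ, hβr⟩ := exists_exponent_gap (N := N) hr (fun h => by
    have := mul_lt_mul_of_pos_right (hrp h) hp0
    rwa [div_mul_eq_mul_div] at this)
  obtain ⟨C, hC0, hC⟩ := exists_abs_rpow_le_of_phi hp hβ
  obtain ⟨K, hK⟩ := HasGradW0.exists_eLpNorm_one_add_rpow_le hΩb hN hp.le hpN hr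
    (hp0.trans hβ) hβr M
  refine ⟨C.toNNReal * K, fun u G h hG => ?_⟩
  refine (eLpNorm_le_mul_of_norm_le (c := C) (g := fun x => (1 + |phi p (u x)|) ^ β)
    (ae_of_all _ fun x => ?_)).trans ?_
  · rw [Real.norm_of_nonneg (by positivity), Real.norm_of_nonneg (by positivity)]
    exact hC _
  · rw [ENNReal.coe_mul]
    exact mul_le_mul_right (hK _ G h hG) _

/-- Bounds for `|∇u| ^ (p - 1)` in terms of `∇[φ_p(u)]`. -/
theorem exists_eLpNorm_norm_grad_rpow_le (hΩb : Bornology.IsBounded Ω) (hN : 2 ≤ N) {p : ℝ}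
    (hp : 1 < p) (hpN : p ≤ N) {q : ℝ} (hq : 0 < q) (hqN : q < N / (N - 1)) (M : ℝ≥0) :
    ∃ K : ℝ≥0, ∀ (u : EuclideanSpace ℝ (Fin N) → ℝ) G,
      HasGradW0 p Ω (fun x => phi p (u x)) G →
      eLpNorm G (ENNReal.ofReal p) (volume.restrict Ω) ≤ M →
      eLpNorm (fun x => ‖(1 / phiDeriv p (u x)) • G x‖ ^ (p - 1)) (ENNReal.ofReal q)
        (volume.restrict Ω) ≤ K := by
  have hp0 : 0 < p := by linarith
  have hp1 : 0 < p - 1 := by linarith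
  have hN' : (2 : ℝ) ≤ N := by exact_mod_cast hN
  have hqinv : 1 - 1 / (N : ℝ) < 1 / q := by
    have e : 1 - 1 / (N : ℝ) = 1 / (N / (N - 1)) := by field_simp
    rw [e]
    exact one_div_lt_one_div_of_lt hq hqN
  have hpNinv : 1 / (N : ℝ) ≤ 1 / p := one_div_le_one_div_of_le hp0 hpN
  -- Hölder's inequality pairs ‖G‖^{p-1} in L^{p/(p-1)} with (1 + |φ_p(u)|)^β in L^{1/τ}. The
  -- condition q < N/(N - 1) says exactly that τ > 1/p - 1/N, i.e. that 1/τ is subcritical when p <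
  -- N.
  set τ := 1 / q - (p - 1) / p with hτ
  have hτ1 : 1 / p - 1 / (N : ℝ) < τ := by
    have : (p - 1) / p = 1 - 1 / p := by field_simp
    rw [hτ, this]; linarith
  have hτ0 : 0 < τ := by linarith
  obtain ⟨β, hβ, hβr⟩ := exists_exponent_gap (N := N) (p := p) (t := 1 / τ) (b := 1) (by positivity)
    (fun h => by
      have e : (N : ℝ) * p / (N - p) = 1 / (1 / p - 1 / (N : ℝ)) := by
        have : (N : ℝ) - p ≠ 0 := by linarith
        field_simp
      rw [e, mul_one]
      refine one_div_lt_one_div_of_lt ?_ hτ1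
      exact sub_pos.2 (one_div_lt_one_div_of_lt hp0 h))
  obtain ⟨C, hC0, hC⟩ := exists_inv_phiDeriv_rpow_le_of_phi hp hβ
  obtain ⟨K, hK⟩ := HasGradW0.exists_eLpNorm_one_add_rpow_le hΩb hN hp.le hpN
    (r := 1 / τ) (by positivity) (one_pos.trans hβ) hβr M
  have hH : ENNReal.HolderTriple (ENNReal.ofReal (1 / τ)) (ENNReal.ofReal (p / (p - 1)))
      (ENNReal.ofReal q) := ⟨by
    rw [← ENNReal.ofReal_inv_of_pos (by positivity), ← ENNReal.ofReal_inv_of_pos (by positivity),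
      ← ENNReal.ofReal_inv_of_pos hq, ← ENNReal.ofReal_add (by positivity) (by positivity)]
    congr 1
    rw [one_div, inv_inv, inv_div, hτ]
    ring⟩
  refine ⟨C.toNNReal * (K * M ^ (p - 1)), fun u G h hG => ?_⟩
  refine (eLpNorm_le_mul_of_norm_le (c := C)
    (g := fun x => (1 + |phi p (u x)|) ^ β • ‖G x‖ ^ (p - 1)) (ae_of_all _ fun x => ?_)).trans ?_
  · have hg := phiDeriv_pos p (u x)
    rw [Real.norm_of_nonneg (by positivity), smul_eq_mul, Real.norm_of_nonneg (by positivity),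
      norm_smul, Real.mul_rpow (norm_nonneg _) (norm_nonneg _),
      Real.norm_of_nonneg (by positivity), ← mul_assoc]
    gcongr
    exact hC _
  · rw [ENNReal.coe_mul, ENNReal.coe_mul]
    refine mul_le_mul_right ?_ _
    have m1 : AEStronglyMeasurable (fun x => (1 + |phi p (u x)|) ^ β) (volume.restrict Ω) := by
      have hc : Continuous fun s : ℝ => (1 + |s|) ^ β :=
        (continuous_const.add continuous_abs).rpow_const fun s =>
          Or.inl (show 1 + |s| ≠ 0 by positivity)
      exact hc.comp_aestronglyMeasurable h.1.1
    have m2 : AEStronglyMeasurable (fun x => ‖G x‖ ^ (p - 1)) (volume.restrict Ω) := by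
      have hc : Continuous fun s : ℝ => s ^ (p - 1) :=
        continuous_id.rpow_const fun s => Or.inr hp1.le
      exact hc.comp_aestronglyMeasurable h.2.1.1.norm
    refine (eLpNorm_smul_le_mul_eLpNorm (p := ENNReal.ofReal (1 / τ))
      (q := ENNReal.ofReal (p / (p - 1))) m2 m1).trans ?_
    refine mul_le_mul' (hK _ G h hG) ?_
    rw [eLpNorm_norm_rpow _ hp1, ← ENNReal.ofReal_mul (div_pos hp0 hp1).le, div_mul_cancel₀ _ hp1.ne',
      ENNReal.coe_rpow_of_nonneg _ hp1.le]
    gcongr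

/-! ### The gradient in the sense of truncations -/

/-- Measurability is only built in for φ_p(u); it passes to u through the continuous inverse of φ_p.
-/
theorem MemPhi.aestronglyMeasurable {p : ℝ} (hp : 1 < p) {u : EuclideanSpace ℝ (Fin N) → ℝ}
    (hu : MemPhi p Ω u) : AEStronglyMeasurable u (volume.restrict Ω) := by
  obtain ⟨ψ, hψ, hψφ, -, -⟩ := exists_phi_inverse hp
  have := hψ.continuous.comp_aestronglyMeasurable hu.1.1.1
  simpa only [hψφ] using this

theorem isBoundedSmoothLimit_truncDeriv {p k : ℝ} (hk : 0 < k) {ψ : ℝ → ℝ}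
    (hψ : ContDiff ℝ ∞ ψ) : IsBoundedSmoothLimit
      (indicator {t | |t| < phi p k} fun t => 1 / phiDeriv p (ψ t)) :=
  isBoundedSmoothLimit_indicator (phi_pos hk)
    (contDiff_const.div ((contDiff_phiDeriv p).comp hψ) fun _ => (phiDeriv_pos p _).ne')

/-- Truncations of `u ∈ Φ^{1,p}_0(Ω)` belong to `W^{1,p}_0(Ω)`. -/
theorem HasGradW0.trunc {p : ℝ} (hp : 1 < p) {u : EuclideanSpace ℝ (Fin N) → ℝ}
    {G : EuclideanSpace ℝ (Fin N) → EuclideanSpace ℝ (Fin N)}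
    (h : HasGradW0 p Ω (fun x => phi p (u x)) G) {k : ℝ} (hk : 0 < k) :
    HasGradW0 p Ω (fun x => trunc k (u x))
      (indicator {x | |u x| < k} fun x => (1 / phiDeriv p (u x)) • G x) := by
  obtain ⟨ψ, hψ, hψφ, -, hd⟩ := exists_phi_inverse hp
  have h1 := h.integral_comp hp.le (isBoundedSmoothLimit_truncDeriv (p := p) hk hψ)
  have e1 : (fun x => ∫ t in (0 : ℝ)..phi p (u x),
      indicator {t | |t| < phi p k} (fun t => 1 / phiDeriv p (ψ t)) t) =
      fun x => _root_.trunc k (u x) := funext fun x => (trunc_eq_integral hk hψ hψφ hd).symm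
  have e2 : (fun x => indicator {t | |t| < phi p k} (fun t => 1 / phiDeriv p (ψ t))
      (phi p (u x)) • G x) =
      indicator {x | |u x| < k} fun x => (1 / phiDeriv p (u x)) • G x := by
    ext1 x
    by_cases hx : |u x| < k
    · rw [indicator_of_mem (show phi p (u x) ∈ {t | |t| < phi p k} from abs_phi_lt_iff.2 hx),
        indicator_of_mem (show x ∈ {x | |u x| < k} from hx), hψφ]
    · rw [indicator_of_notMem (show phi p (u x) ∉ {t | |t| < phi p k} from
        fun h' => hx (abs_phi_lt_iff.1 h')),
        indicator_of_notMem (show x ∉ {x | |u x| < k} from hx), zero_smul]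
  rwa [e1, e2] at h1

/-- The formula ∇u = ∇[φ_p(u)] / φ_p'(u) is what turns bounds on ∇[φ_p(u)] into bounds on ∇u. -/
theorem MemPhi.hasTruncGrad [IsFiniteMeasure (volume.restrict Ω)] (hΩ : IsOpen Ω) {p : ℝ}
    (hp : 1 < p) {u : EuclideanSpace ℝ (Fin N) → ℝ} (hu : MemPhi p Ω u) :
    HasTruncGrad p Ω u
      (fun x => (1 / phiDeriv p (u x)) • weakGrad Ω (fun x => phi p (u x)) x) := by
  have hG := MemW1p0.hasGradW0 hΩ hu
  refine ⟨AEStronglyMeasurable.smul (f := fun x => 1 / phiDeriv p (u x)) ?_ hG.2.1.1,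
    fun k hk => ?_⟩
  · have hc : Continuous fun s => 1 / phiDeriv p s :=
      continuous_const.div (continuous_phiDeriv p) fun s => (phiDeriv_pos p s).ne'
    exact hc.comp_aestronglyMeasurable (hu.aestronglyMeasurable hp)
  · have h1 := hG.trunc hp hk
    exact ⟨h1.memW1p0 hΩ hp.le, h1.weakGrad_ae_eq hΩ hp.le⟩

/-- Countably many levels n + 1 suffice, since the sets {|u| < n + 1} exhaust the space. -/
theorem HasTruncGrad.ae_unique {p : ℝ} {u : EuclideanSpace ℝ (Fin N) → ℝ}
    {G H : EuclideanSpace ℝ (Fin N) → EuclideanSpace ℝ (Fin N)}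
    (hG : HasTruncGrad p Ω u G) (hH : HasTruncGrad p Ω u H) : G =ᵐ[volume.restrict Ω] H := by
  have h : ∀ᵐ x ∂(volume.restrict Ω), ∀ n : ℕ,
      indicator {x | |u x| < (n : ℝ) + 1} G x = indicator {x | |u x| < (n : ℝ) + 1} H x :=
    ae_all_iff.2 fun n =>
      ((hG.2 _ (by positivity)).2.symm.trans (hH.2 ((n : ℝ) + 1) (by positivity)).2)
  filter_upwards [h] with x hx
  obtain ⟨n, hn⟩ := exists_nat_gt |u x|
  have hmem : x ∈ {x | |u x| < (n : ℝ) + 1} := by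
    change |u x| < (n : ℝ) + 1
    linarith
  have := hx n
  rwa [indicator_of_mem hmem, indicator_of_mem hmem] at this

theorem MemPhi.hasTruncGrad_truncGrad [IsFiniteMeasure (volume.restrict Ω)] (hΩ : IsOpen Ω)
    {p : ℝ} (hp : 1 < p) {u : EuclideanSpace ℝ (Fin N) → ℝ} (hu : MemPhi p Ω u) :
    HasTruncGrad p Ω u (truncGrad p Ω u) := by
  have hex : ∃ G, HasTruncGrad p Ω u G := ⟨_, hu.hasTruncGrad hΩ hp⟩
  rw [truncGrad, dif_pos hex]
  exact hex.choose_spec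

theorem MemPhi.truncGrad_ae_eq [IsFiniteMeasure (volume.restrict Ω)] (hΩ : IsOpen Ω)
    {p : ℝ} (hp : 1 < p) {u : EuclideanSpace ℝ (Fin N) → ℝ} (hu : MemPhi p Ω u) :
    truncGrad p Ω u =ᵐ[volume.restrict Ω]
      fun x => (1 / phiDeriv p (u x)) • weakGrad Ω (fun x => phi p (u x)) x :=
  (hu.hasTruncGrad_truncGrad hΩ hp).ae_unique (hu.hasTruncGrad hΩ hp)

theorem exists_eLpNorm_truncGrad_rpow_le (hΩ : IsOpen Ω) (hΩb : Bornology.IsBounded Ω)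
    (hN : 2 ≤ N) {p : ℝ} (hp : 1 < p) (hpN : p ≤ N) {q : ℝ} (hq : 0 < q)
    (hqN : q < N / (N - 1)) (M : ℝ≥0) :
    ∃ K : ℝ≥0, ∀ u, MemPhi p Ω u →
      eLpNorm (weakGrad Ω fun x => phi p (u x)) (ENNReal.ofReal p) (volume.restrict Ω) ≤ M →
      eLpNorm (fun x => ‖truncGrad p Ω u x‖ ^ (p - 1)) (ENNReal.ofReal q)
        (volume.restrict Ω) ≤ K := by
  have := isFiniteMeasure_restrict_of_isBounded hΩb
  obtain ⟨K, hK⟩ := exists_eLpNorm_norm_grad_rpow_le hΩb hN hp hpN hq hqN M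
  refine ⟨K, fun u hu hM => ?_⟩
  refine (eLpNorm_congr_ae ?_).trans_le (hK u _ (MemW1p0.hasGradW0 hΩ hu) hM)
  filter_upwards [hu.truncGrad_ae_eq hΩ hp] with x hx
  rw [hx]

/-- A bound on mutual distances becomes a bound on norms by comparison with the fixed element u 0.
-/
theorem BoundedInPhi.exists_bound (hΩ : IsOpen Ω) {p : ℝ} (hp : 1 ≤ p)
    {u : ℕ → EuclideanSpace ℝ (Fin N) → ℝ} (h : BoundedInPhi p Ω u) :
    ∃ M : ℝ≥0, ∀ n, eLpNorm (weakGrad Ω fun x => phi p (u n x)) (ENNReal.ofReal p)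
      (volume.restrict Ω) ≤ M := by
  have hP : 1 ≤ ENNReal.ofReal p := by simpa using ENNReal.ofReal_le_ofReal hp
  obtain ⟨hu, C, hC⟩ := h
  have hm := fun n => (MemW1p0.hasGradW0 hΩ (hu n)).2.1
  refine ⟨C + (eLpNorm (weakGrad Ω fun x => phi p (u 0 x)) (ENNReal.ofReal p)
    (volume.restrict Ω)).toNNReal, fun n => ?_⟩
  rw [ENNReal.coe_add, ENNReal.coe_toNNReal (hm 0).2.ne]
  have e : (weakGrad Ω fun x => phi p (u n x)) =
      ((weakGrad Ω fun x => phi p (u n x)) - weakGrad Ω fun x => phi p (u 0 x)) +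
        weakGrad Ω fun x => phi p (u 0 x) := by abel
  rw [e]
  exact (eLpNorm_add_le ((hm n).1.sub (hm 0).1) (hm 0).1 hP).trans
    (add_le_add (hC n 0) le_rfl)

/-! ### Strong convergence -/

theorem norm_norm_rpow_smul {V : Type*} [NormedAddCommGroup V] [NormedSpace ℝ V] {p : ℝ}
    (hp : 1 < p) (ξ : V) : ‖‖ξ‖ ^ (p - 2) • ξ‖ = ‖ξ‖ ^ (p - 1) := by
  rw [norm_smul, Real.norm_of_nonneg (by positivity)]
  rcases eq_or_ne ξ 0 with rfl | h
  · simp [Real.zero_rpow (show p - 1 ≠ 0 by linarith)]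
  · nth_rw 2 [← Real.rpow_one ‖ξ‖]
    rw [← Real.rpow_add (norm_pos_iff.2 h)]
    congr 1; ring

/-- Only ξ = 0 needs care: the factor ‖ξ‖^{p-2} may blow up there, but the product has norm
‖ξ‖^{p-1}, which tends to 0 because p > 1. -/
theorem continuous_norm_rpow_smul {V : Type*} [NormedAddCommGroup V] [NormedSpace ℝ V] {p : ℝ}
    (hp : 1 < p) : Continuous fun ξ : V => ‖ξ‖ ^ (p - 2) • ξ := by
  rw [continuous_iff_continuousAt]
  intro ξ
  rcases eq_or_ne ξ 0 with rfl | h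
  · rw [ContinuousAt, smul_zero, tendsto_zero_iff_norm_tendsto_zero]
    simp_rw [norm_norm_rpow_smul hp]
    have hc : Continuous fun ξ : V => ‖ξ‖ ^ (p - 1) :=
      continuous_norm.rpow_const fun _ => Or.inr (by linarith)
    simpa [Real.zero_rpow (show p - 1 ≠ 0 by linarith)] using hc.tendsto 0
  · exact (continuous_norm.continuousAt.rpow_const (Or.inl (norm_ne_zero_iff.2 h))).smul
      continuousAt_id

/-- Fatou's lemma gives the limit the same L^s bound, and Vitali's theorem applies to the
differences. -/
theorem TendstoLq.of_bounded [IsFiniteMeasure (volume.restrict Ω)] {V : Type*}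
    [NormedAddCommGroup V] {q s : ℝ} (hq : 0 < q) (hqs : q < s)
    {f : ℕ → EuclideanSpace ℝ (Fin N) → V} {g : EuclideanSpace ℝ (Fin N) → V}
    (hf : ∀ n, AEStronglyMeasurable (f n) (volume.restrict Ω))
    (hg : AEStronglyMeasurable g (volume.restrict Ω)) {K : ℝ≥0}
    (hK : ∀ n, eLpNorm (f n) (ENNReal.ofReal s) (volume.restrict Ω) ≤ K)
    (hlim : ∀ᵐ x ∂(volume.restrict Ω), Tendsto (fun n => f n x) atTop (𝓝 (g x))) :
    TendstoLq q Ω f g := by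
  have hle : ENNReal.ofReal q ≤ ENNReal.ofReal s := ENNReal.ofReal_le_ofReal hqs.le
  have hgK : eLpNorm g (ENNReal.ofReal s) (volume.restrict Ω) ≤ K :=
    Lp.eLpNorm_le_of_ae_tendsto (Eventually.of_forall hK) hf hlim
  refine ⟨fun n => MemLp.mono_exponent ⟨hf n, (hK n).trans_lt ENNReal.coe_lt_top⟩ hle,
    MemLp.mono_exponent ⟨hg, hgK.trans_lt ENNReal.coe_lt_top⟩ hle, ?_⟩
  have hB : ENNReal.LpAddConst (ENNReal.ofReal s) * (K + K) ≠ ⊤ :=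
    ENNReal.mul_ne_top (ENNReal.LpAddConst_lt_top _).ne (by simp)
  lift ENNReal.LpAddConst (ENNReal.ofReal s) * (K + K) to ℝ≥0 using hB with B hB'
  refine tendsto_eLpNorm_zero_of_bounded hq hqs (C := B) (fun n => (hf n).sub hg) (fun n => ?_) ?_
  · rw [hB']
    refine (eLpNorm_sub_le' (hf n) hg _).trans ?_
    gcongr
    exact hK n
  · filter_upwards [hlim] with x hx
    simpa using hx.sub_const (g x)

/-- Strong convergence of truncations. -/
theorem TendstoPhi.tendstoW1p0_trunc (hΩ : IsOpen Ω) (hΩb : Bornology.IsBounded Ω) (hN : 2 ≤ N)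
    {p : ℝ} (hp : 1 < p) (hpN : p ≤ N) {u : ℕ → EuclideanSpace ℝ (Fin N) → ℝ}
    {w : EuclideanSpace ℝ (Fin N) → ℝ} (h : TendstoPhi p Ω u w) {k : ℝ} (hk : 0 < k) :
    TendstoW1p0 p Ω (fun n x => trunc k (u n x)) (fun x => trunc k (w x)) := by
  have := isFiniteMeasure_restrict_of_isBounded hΩb
  have hp0 : 0 < p := by linarith
  obtain ⟨hu, hw, hlim⟩ := h
  have hun := fun n => MemW1p0.hasGradW0 hΩ (hu n)
  have hwG := MemW1p0.hasGradW0 hΩ hw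
  obtain ⟨s, hps, hsp⟩ := exists_exponent_between hN hp
  obtain ⟨S, hS⟩ := HasGradW0.sobolev hΩb hN hp.le hpN hp0 (fun h => hps.trans (hsp h))
  -- The metric sees only gradients; the Sobolev inequality at exponent p (a Poincaré inequality)
  -- recovers convergence of the functions.
  have hv : Tendsto (fun n => eLpNorm ((fun x => phi p (u n x)) - fun x => phi p (w x))
      (ENNReal.ofReal p) (volume.restrict Ω)) atTop (𝓝 0) := by
    have h1 := ENNReal.Tendsto.const_mul (a := (S : ℝ≥0∞)) hlim (Or.inr ENNReal.coe_ne_top)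
    rw [mul_zero] at h1
    exact tendsto_of_tendsto_of_tendsto_of_le_of_le tendsto_const_nhds h1 (fun _ => zero_le)
      fun n => hS _ _ ((hun n).sub hp.le hwG)
  obtain ⟨ψ, hψ, hψφ, -, hd⟩ := exists_phi_inverse hp
  have hγ := isBoundedSmoothLimit_truncDeriv (p := p) hk hψ
  have e : ∀ u : EuclideanSpace ℝ (Fin N) → ℝ, (fun x => trunc k (u x)) =
      fun x => ∫ t in (0 : ℝ)..phi p (u x),
        indicator {t | |t| < phi p k} (fun t => 1 / phiDeriv p (ψ t)) t := fun u =>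
    funext fun x => trunc_eq_integral hk hψ hψφ hd
  have e' : (fun n x => trunc k (u n x)) = fun n x => ∫ t in (0 : ℝ)..phi p (u n x),
      indicator {t | |t| < phi p k} (fun t => 1 / phiDeriv p (ψ t)) t := funext fun n => e (u n)
  rw [e', e w]
  obtain ⟨M, hM⟩ := hγ.exists_bound
  refine TendstoW1p0.of_hasGradW0 hΩ hp.le (fun n => (hun n).integral_comp hp.le hγ)
    (hwG.integral_comp hp.le hγ) (HasGradW0.tendsto_integral_comp hM hγ.measurable hv) ?_
  -- A.e. convergence is available only along subsequences, which is enough because the limit is the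
  -- same for all of them.
  refine tendsto_of_subseq_tendsto fun ns hns => ?_
  obtain ⟨σ, hσ, hae⟩ := exists_subseq_ae_tendsto hp0 (fun n => (hun (ns n)).1.1) hwG.1.1
    (hv.comp hns)
  refine ⟨σ, HasGradW0.tendsto_comp_smul hp.le hM hγ.measurable
    (w := fun n x => phi p (u (ns (σ n)) x))
    (H := fun n => weakGrad Ω fun x => phi p (u (ns (σ n)) x))
    (fun n => (hun _).1.1) (fun n => (hun _).2.1.1) hwG.1.1 hwG.2.1 ?_
    (hlim.comp (hns.comp hσ.tendsto_atTop))⟩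
  -- The integrand jumps at ±φ_p(k), but a.e. where φ_p(w) takes these values its gradient is zero.
  -- Elsewhere the indicator is locally constant.
  filter_upwards [hae, hwG.ae_eq_zero_of_eq hΩ hp.le (phi p k),
    hwG.ae_eq_zero_of_eq hΩ hp.le (-phi p k)] with x hx h1 h2
  by_cases hx0 : weakGrad Ω (fun x => phi p (w x)) x = 0
  · simp [hx0]
  · refine Tendsto.smul_const ?_ _
    have hne : |phi p (w x)| ≠ phi p k := fun h' => by
      rcases eq_or_eq_neg_of_abs_eq h' with h' | h'
      · exact hx0 (h1 h')
      · exact hx0 (h2 h')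
    rcases lt_or_gt_of_ne hne with hlt | hgt
    · have hc : Continuous fun t => 1 / phiDeriv p (ψ t) :=
        continuous_const.div ((continuous_phiDeriv p).comp hψ.continuous)
          fun t => (phiDeriv_pos p _).ne'
      rw [indicator_of_mem (show phi p (w x) ∈ {t | |t| < phi p k} from hlt)]
      refine ((hc.tendsto _).comp hx).congr' ?_
      filter_upwards [hx.abs.eventually (gt_mem_nhds hlt)] with n hn
      exact (indicator_of_mem (s := {t | |t| < phi p k}) hn
          (fun t => 1 / phiDeriv p (ψ t))).symm
    · rw [indicator_of_notMem (show phi p (w x) ∉ {t | |t| < phi p k} from not_lt.2 hgt.le)]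
      refine tendsto_const_nhds.congr' ?_
      filter_upwards [hx.abs.eventually (lt_mem_nhds hgt)] with n hn
      exact (indicator_of_notMem (s := {t | |t| < phi p k}) (not_lt.2 hn.le)
          (fun t => 1 / phiDeriv p (ψ t))).symm

end W0

/-! ### Proof of the theorem -/

theorem mainTheorem12 (N : ℕ) (hN : 2 ≤ N) (p : ℝ) (hp1 : 1 < p) (hpN : p ≤ N)
    (Ω : Set (EuclideanSpace ℝ (Fin N))) (hΩ : IsOpen Ω) (hΩb : Bornology.IsBounded Ω) :
    -- (a)
    (∀ u : EuclideanSpace ℝ (Fin N) → ℝ, MemPhi p Ω u →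
      HasTruncGrad p Ω u (truncGrad p Ω u) ∧
      (∀ q : ℝ, 0 < q → q < N / (N - 1) →
        MemLp (fun x => ‖truncGrad p Ω u x‖ ^ (p - 1)) (ENNReal.ofReal q)
          (volume.restrict Ω)) ∧
      (∀ r : ℝ, 0 < r → (p < N → r < N / (N - p)) →
        MemLp (fun x => |u x| ^ (p - 1)) (ENNReal.ofReal r) (volume.restrict Ω))) ∧
    -- (b)
    (∀ u : ℕ → EuclideanSpace ℝ (Fin N) → ℝ, BoundedInPhi p Ω u →
      (∀ q : ℝ, 0 < q → q < N / (N - 1) →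
        ∃ C : ℝ≥0, ∀ n, eLpNorm (fun x => ‖truncGrad p Ω (u n) x‖ ^ (p - 1))
          (ENNReal.ofReal q) (volume.restrict Ω) ≤ C) ∧
      ∃ w : EuclideanSpace ℝ (Fin N) → ℝ, MemPhi p Ω w ∧
        ∃ σ : ℕ → ℕ, StrictMono σ ∧
          ∀ r : ℝ, 0 < r → (p < N → r < N / (N - p)) →
            TendstoLq r Ω (fun n x => |u (σ n) x| ^ (p - 2) * u (σ n) x)
              (fun x => |w x| ^ (p - 2) * w x)) ∧
    -- (c)
    (∀ (u : ℕ → EuclideanSpace ℝ (Fin N) → ℝ) (w : EuclideanSpace ℝ (Fin N) → ℝ),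
      BoundedInPhi p Ω u → MemPhi p Ω w →
      (∀ᵐ x ∂(volume.restrict Ω),
        Tendsto (fun n => truncGrad p Ω (u n) x) atTop (𝓝 (truncGrad p Ω w x))) →
      ∀ q : ℝ, 0 < q → q < N / (N - 1) →
        TendstoLq q Ω
          (fun n x => ‖truncGrad p Ω (u n) x‖ ^ (p - 2) • truncGrad p Ω (u n) x)
          (fun x => ‖truncGrad p Ω w x‖ ^ (p - 2) • truncGrad p Ω w x)) ∧
    -- (d)
    (∀ (u : ℕ → EuclideanSpace ℝ (Fin N) → ℝ) (w : EuclideanSpace ℝ (Fin N) → ℝ),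
      TendstoPhi p Ω u w →
      ∀ k : ℝ, 0 < k →
        TendstoW1p0 p Ω (fun n x => trunc k (u n x)) (fun x => trunc k (w x))) := by
  have := isFiniteMeasure_restrict_of_isBounded hΩb
  have hp0 : 0 < p := by linarith
  have hN' : (2 : ℝ) ≤ N := by exact_mod_cast hN
  have hgradm : ∀ u, MemPhi p Ω u →
      AEStronglyMeasurable (truncGrad p Ω u) (volume.restrict Ω) := fun u hu =>
    (hu.hasTruncGrad_truncGrad hΩ hp1).1
  have hpow : ∀ {f : EuclideanSpace ℝ (Fin N) → ℝ},
      AEStronglyMeasurable f (volume.restrict Ω) →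
      AEStronglyMeasurable (fun x => |f x| ^ (p - 1)) (volume.restrict Ω) := fun hf => by
    have hc : Continuous fun s : ℝ => |s| ^ (p - 1) :=
      continuous_abs.rpow_const fun _ => Or.inr (by linarith)
    exact hc.comp_aestronglyMeasurable hf
  refine ⟨fun u hu => ⟨hu.hasTruncGrad_truncGrad hΩ hp1, fun q hq hqN => ⟨?_, ?_⟩,
    fun r hr hrp => ⟨hpow (hu.aestronglyMeasurable hp1), ?_⟩⟩, fun u hu => ⟨fun q hq hqN => ?_, ?_⟩,
    fun u w hu hw hlim q hq hqN => ?_, fun u w h k hk => h.tendstoW1p0_trunc hΩ hΩb hN hp1 hpN hk⟩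
  · simpa using hpow (hgradm u hu).norm
  · have hG := (MemW1p0.hasGradW0 hΩ hu).2.1.2
    obtain ⟨K, hK⟩ := exists_eLpNorm_truncGrad_rpow_le hΩ hΩb hN hp1 hpN hq hqN
      (eLpNorm (weakGrad Ω fun x => phi p (u x)) (ENNReal.ofReal p) (volume.restrict Ω)).toNNReal
    exact (hK u hu (ENNReal.coe_toNNReal hG.ne).ge).trans_lt ENNReal.coe_lt_top
  · have hG := MemW1p0.hasGradW0 hΩ hu
    obtain ⟨K, hK⟩ := exists_eLpNorm_abs_rpow_le hΩb hN hp1 hpN hr hrp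
      (eLpNorm (weakGrad Ω fun x => phi p (u x)) (ENNReal.ofReal p) (volume.restrict Ω)).toNNReal
    exact (hK u _ hG (ENNReal.coe_toNNReal hG.2.1.2.ne).ge).trans_lt ENNReal.coe_lt_top
  · obtain ⟨M, hM⟩ := hu.exists_bound hΩ hp1.le
    obtain ⟨K, hK⟩ := exists_eLpNorm_truncGrad_rpow_le hΩ hΩb hN hp1 hpN hq hqN M
    exact ⟨K, fun n => hK _ (hu.1 n) (hM n)⟩
  · obtain ⟨M, hM⟩ := hu.exists_bound hΩ hp1.le
    have hG := fun n => MemW1p0.hasGradW0 hΩ (hu.1 n)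
    obtain ⟨v, H, hv, σ, hσ, hae⟩ := exists_subseq_ae_tendsto_of_bounded hΩb hN hp1 hpN hG hM
    obtain ⟨ψ, hψ, hψφ, hφψ, -⟩ := exists_phi_inverse hp1
    -- The compactness limit v is a limit of φ_p(u_n), so the limit of u_n itself is ψ(v). It serves
    -- all exponents r at once.
    have hw : MemPhi p Ω (fun x => ψ (v x)) := by
      have := hv.memW1p0 hΩ hp1.le
      simpa only [MemPhi, hφψ] using this
    refine ⟨fun x => ψ (v x), hw, σ, hσ, fun r hr hrp => ?_⟩
    obtain ⟨s, hrs, hsp⟩ : ∃ s, r < s ∧ (p < N → s < N / (N - p)) := by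
      by_cases h : p < N
      · obtain ⟨s, h1, h2⟩ := exists_between (hrp h)
        exact ⟨s, h1, fun _ => h2⟩
      · exact ⟨r + 1, by linarith, fun h' => absurd h' h⟩
    obtain ⟨K, hK⟩ := exists_eLpNorm_abs_rpow_le hΩb hN hp1 hpN (hr.trans hrs) hsp M
    have hc : Continuous fun s : ℝ => |s| ^ (p - 2) * s := continuous_norm_rpow_smul hp1
    refine TendstoLq.of_bounded hr hrs (K := K)
      (fun n => hc.comp_aestronglyMeasurable ((hu.1 (σ n)).aestronglyMeasurable hp1))
      (hc.comp_aestronglyMeasurable (hw.aestronglyMeasurable hp1)) (fun n => ?_) ?_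
    · refine (eLpNorm_congr_norm_ae (ae_of_all _ fun x => ?_)).trans_le (hK _ _ (hG (σ n)) (hM _))
      have h1 := norm_norm_rpow_smul hp1 (u (σ n) x)
      have h2 : 0 ≤ |u (σ n) x| ^ (p - 1) := by positivity
      rw [Real.norm_of_nonneg h2]
      exact h1
    · filter_upwards [hae] with x hx
      have h1 := (hψ.continuous.tendsto _).comp hx
      simp only [Function.comp_def, hψφ] at h1
      exact (hc.tendsto _).comp h1
  -- An exponent s above q but still admissible gives the uniform bound for Vitali's theorem; no
  -- convergence of u_n itself is needed.
  · obtain ⟨s, hqs, hsN⟩ := exists_between hqN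
    obtain ⟨M, hM⟩ := hu.exists_bound hΩ hp1.le
    obtain ⟨K, hK⟩ := exists_eLpNorm_truncGrad_rpow_le hΩ hΩb hN hp1 hpN (hq.trans hqs) hsN M
    have hc : Continuous fun ξ : EuclideanSpace ℝ (Fin N) => ‖ξ‖ ^ (p - 2) • ξ :=
      continuous_norm_rpow_smul hp1
    refine TendstoLq.of_bounded hq hqs (K := K)
      (fun n => hc.comp_aestronglyMeasurable (hgradm _ (hu.1 n)))
      (hc.comp_aestronglyMeasurable (hgradm _ hw)) (fun n => ?_) ?_
    · refine (eLpNorm_congr_norm_ae (ae_of_all _ fun x => ?_)).trans_le (hK _ (hu.1 n) (hM n))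
      rw [norm_norm_rpow_smul hp1, Real.norm_of_nonneg (by positivity)]
    · filter_upwards [hlim] with x hx
      exact (hc.tendsto _).comp hx
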